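/- **Notation.** For $C\subseteq\mathbb R^m$: $\sigma_C(y)=\sup_{\lambda\in C}\langle\lambda,y\rangle$ is the support function, $\iota_C$ the indicator function ($0$ on $C$, $+\infty$ off $C$), $\mathrm{aff}(C)$ the affine hull. If $C$ is convex, $\mathrm{lin}(C)$ is its lineality space (for a convex cone $K\ni 0$: $K\cap(-K)$), and $N_C(\lambda)=\{v:\langle v,\mu-\lambda\rangle\le 0\ \forall \mu\in C\}$. Further $$T_C(\lambda)=\limsup_{t\downarrow0}\frac{C-\lambda}{t},\qquad T_C^2(\lambda,p)=\limsup_{t\downarrow0}\frac{C-\lambda-tp}{\tfrac12t^2}$$ are the tangent cone and the outer second-order tangent set. Limits of sets are in the sense of Painlevé–Kuratowski, and $\mathrm{dist}(0,\emptyset)=\infty$. $\partial$ is the limiting subdifferential. For $\theta:\mathbb R^n\to(-\infty,\infty]$ and $x\in\mathrm{dom}\,\theta$, $$\Delta_t^2\theta(x|a)(h)=\frac{\theta(x+th)-\theta(x)-t\langle a,h\rangle}{\tfrac12t^2},\qquad \mathrm d^2\theta(x|a)(h)=\liminf_{t\downarrow0,\ \tilde h\to h}\Delta_t^2\theta(x|a)(\tilde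 h);$$ $\theta$ is *twice epi-differentiable* at $x$ for $a$ if $\Delta_t^2\theta(x|a)$ epi-converges as $t\downarrow0$; and $(\text{e-liminf}_k\,\theta_k)(w)=\liminf_{k\to\infty,\ \tilde w\to w}\theta_k(\tilde w)$. A function is *generalized quadratic* if it has the form $w\mapsto\langle w,Aw\rangle+\iota_L(w)$ with $A$ symmetric and $L$ a linear subspace. **Setting.** Let $\varphi:\mathbb R^n\to(-\infty,\infty]$ be $C^2$-strictly decomposable at $\bar x\in\mathrm{dom}\,\varphi$ for $\bar\lambda$ with decomposition pair $(\sigma_C,F)$, that is: $C\subseteq\mathbb R^m$ is a nonempty closed convex set, $\bar\lambda\in C$, $F:\mathbb R^n\to\mathbb R^m$ satisfies $F(\bar x)=0$, there is an open neighborhood $U$ of $\bar x$ on which $F$ is twice continuously differentiable and $\varphi(x)=\varphi(\bar x)+\sigma_C(F(x))$ for all $x\in U$, and $$0\in\mathrm{int}\{F(\bar x)+DF(\bar x)\mathbb R^n-\mathrm{dom}\,\sigma_C\},\qquad DF(\bar x)\mathbb R^n-N_C(\bar\lambda)=\mathbb R^m .$$ Let $\bar v=DF(\bar x)^\top\bar\lambda$,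 $H(x,\lambda)=\sum_{i=1}^m\lambda_i\nabla^2F_i(x)$, $S=DF(\bar x)^{-1}N_C(\bar\lambda)$, $\mathsf A=\mathrm{aff}(S)$ (a linear subspace) and $Q=\Pi_{\mathsf A}H(\bar x,\bar\lambda)\Pi_{\mathsf A}$, where $\Pi_{\mathsf A}$ is the orthogonal projection onto $\mathsf A$. **Theorem.** (a) Let $(x^k,v^k)$ be a sequence in the graph of $\partial\varphi$ with $(x^k,v^k)\to(\bar x,\bar v)$ such that $\varphi$ is twice epi-differentiable at $x^k$ for $v^k$ for all $k$. Suppose there are $M>0$ and $\lambda^k\in\partial\sigma_C(F(x^k))$ with $v^k=DF(x^k)^\top\lambda^k$ for all $k$ such that (i) there are linear subspaces $L_k\subseteq\mathrm{lin}(T_C(\lambda^k))$ with $L_k\to\mathrm{lin}(T_C(\bar\lambda))$; (ii) $\mathrm{dist}(0,T_C^2(\lambda^k,p))<M$ for all $k$ and all $p\in L_k$ with $\|p\|=1$. Then, for all $w\in\mathbb R^n$, $$\bigl(\text{e-liminf}_{k\to\infty}\,\mathrm d^2\varphi(x^k|DF(x^k)^\top\lambda^k)\bigr)(w)\ \ge\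 \langle w,H(\bar x,\bar\lambda)w\rangle+\iota_{\mathrm{aff}(DF(\bar x)^{-1}N_C(\bar\lambda))}(w).$$ (b) Suppose that $C$ has the outer second-order tangent path property at $\bar\lambda$: there are $M>0$, a neighborhood $V$ of $\bar\lambda$ and linear subspaces $L(\lambda)\subseteq\mathrm{lin}(T_C(\lambda))$, $\lambda\in C\cap V$, such that $L(\lambda)\to\mathrm{lin}(T_C(\bar\lambda))$ as $C\cap V\ni\lambda\to\bar\lambda$, and $\mathrm{dist}(0,T^2_C(\lambda,p))<M$ for all $\lambda\in C\cap V$ and all $p\in L(\lambda)$ with $\|p\|=1$. Then, for every sequence $(x^k,v^k)\to(\bar x,\bar v)$ in the graph of $\partial\varphi$ such that $\varphi$ is twice epi-differentiable at $x^k$ for $v^k$ and $\mathrm d^2\varphi(x^k|v^k)$ is generalized quadratic for all $k$, we have, for all $w\in\mathbb R^n$, $$\bigl(\text{e-liminf}_{k\to\infty}\,\mathrm d^2\varphi(x^k|v^k)\bigr)(w)\ \ge\ \langle w,Qw\rangle+\iota_{\mathrm{aff}(S)}(w).$$ -/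

import Mathlib

open Filter Topology

noncomputable section

namespace SecondOrderVar

/-! ### Set limits and convex geometry -/

/-- Outer limit of a sequence of sets: limits of points `y k ∈ C (j k)` with `j k → ∞`. -/
def setLimsup {E : Type*} [TopologicalSpace E] (C : ℕ → Set E) : Set E :=
  {x | ∃ (j : ℕ → ℕ) (y : ℕ → E),
    Tendsto j atTop atTop ∧ (∀ k, y k ∈ C (j k)) ∧ Tendsto y atTop (𝓝 x)}

/-- Inner limit of a sequence of sets: limits of points `y k ∈ C k`. -/
def setLiminf {E : Type*} [TopologicalSpace E] (C : ℕ → Set E) : Set E :=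
  {x | ∃ y : ℕ → E, (∀ k, y k ∈ C k) ∧ Tendsto y atTop (𝓝 x)}

/-- Painlevé–Kuratowski convergence of a sequence of sets. -/
def SetConverges {E : Type*} [TopologicalSpace E] (C : ℕ → Set E) (D : Set E) : Prop :=
  setLimsup C = D ∧ setLiminf C = D

/-- The tangent cone `T_C(x) = limsup_{t ↓ 0} (C - x) / t`. -/
def tangentCone {E : Type*} [NormedAddCommGroup E] [NormedSpace ℝ E] (C : Set E) (x : E) :
    Set E :=
  {w | ∃ (t : ℕ → ℝ) (u : ℕ → E), (∀ k, 0 < t k) ∧ Tendsto t atTop (𝓝 0) ∧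
    Tendsto u atTop (𝓝 w) ∧ ∀ k, x + t k • u k ∈ C}

/-- The outer second-order tangent set `T²_C(x, h) = limsup_{t ↓ 0} (C - x - t h) / (t² / 2)`. -/
def outerTangent2 {E : Type*} [NormedAddCommGroup E] [NormedSpace ℝ E] (C : Set E) (x h : E) :
    Set E :=
  {w | ∃ (t : ℕ → ℝ) (u : ℕ → E), (∀ k, 0 < t k) ∧ Tendsto t atTop (𝓝 0) ∧
    Tendsto u atTop (𝓝 w) ∧ ∀ k, x + t k • h + (t k ^ 2 / 2) • u k ∈ C}

/-- The normal cone of a convex set `C` at a point `x ∈ C`. -/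
def normalCone {E : Type*} [NormedAddCommGroup E] [InnerProductSpace ℝ E] (C : Set E) (x : E) :
    Set E :=
  {v | ∀ y ∈ C, inner ℝ v (y - x) ≤ 0}

/-- The lineality space of a convex set: the directions `y` such that `C` contains, with each of
its points, the whole line in direction `y`. For a convex cone `K ∋ 0` this is `K ∩ (-K)`. -/
def lineality {E : Type*} [AddCommGroup E] [Module ℝ E] (C : Set E) : Set E :=
  {y | ∀ x ∈ C, ∀ t : ℝ, x + t • y ∈ C}

open Classical in
/-- The indicator function `ι_S`. -/
def indicatorFun {E : Type*} (S : Set E) (x : E) : EReal := if x ∈ S then 0 else ⊤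

/-- The support function `σ_C`. -/
def supportFun {E : Type*} [NormedAddCommGroup E] [InnerProductSpace ℝ E] (C : Set E) (y : E) :
    EReal :=
  ⨆ l ∈ C, ((inner ℝ l y : ℝ) : EReal)

/-! ### Subdifferentials, epi-limits and second subderivatives -/

/-- The regular subdifferential: `θ y ≥ θ x + ⟨v, y - x⟩ + o(‖y - x‖)`, for `x ∈ dom θ`. -/
def regularSubdiff {E : Type*} [NormedAddCommGroup E] [InnerProductSpace ℝ E] (θ : E → EReal)
    (x : E) : Set E :=
  {v | θ x ≠ ⊤ ∧ ∀ ε : ℝ, 0 < ε →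
    ∀ᶠ y in 𝓝 x, θ x + ((inner ℝ v (y - x) - ε * ‖y - x‖ : ℝ) : EReal) ≤ θ y}

/-- The (limiting) subdifferential: limits of regular subgradients `u k` at points `y k → x` with
`θ (y k) → θ x`, for `x ∈ dom θ`. -/
def subdiff {E : Type*} [NormedAddCommGroup E] [InnerProductSpace ℝ E] (θ : E → EReal)
    (x : E) : Set E :=
  {v | θ x ≠ ⊤ ∧ ∃ (y u : ℕ → E), Tendsto y atTop (𝓝 x) ∧
    Tendsto (fun k => θ (y k)) atTop (𝓝 (θ x)) ∧
    (∀ k, u k ∈ regularSubdiff θ (y k)) ∧ Tendsto u atTop (𝓝 v)}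

/-- The lower epi-limit `x ↦ liminf_{k → ∞, x' → x} θ k x'`. -/
def epiLiminf {E : Type*} [TopologicalSpace E] (θ : ℕ → E → EReal) (x : E) : EReal :=
  liminf (fun p : ℕ × E => θ p.1 p.2) (atTop ×ˢ 𝓝 x)

/-- Epi-convergence of a sequence of extended real-valued functions. -/
def EpiConverges {E : Type*} [TopologicalSpace E] (θ : ℕ → E → EReal) (g : E → EReal) : Prop :=
  ∀ x, (∀ y : ℕ → E, Tendsto y atTop (𝓝 x) → g x ≤ liminf (fun k => θ k (y k)) atTop) ∧
    ∃ y : ℕ → E, Tendsto y atTop (𝓝 x) ∧ limsup (fun k => θ k (y k)) atTop ≤ g x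

/-- The second-order difference quotient
`(θ (x + t h) - θ x - t ⟨a, h⟩) / (t² / 2)`. -/
def diffQuot2 {E : Type*} [NormedAddCommGroup E] [InnerProductSpace ℝ E] (θ : E → EReal)
    (x a : E) (t : ℝ) (h : E) : EReal :=
  (θ (x + t • h) - θ x - ((t * inner ℝ a h : ℝ) : EReal)) / ((t ^ 2 / 2 : ℝ) : EReal)

/-- The second subderivative `d²θ(x|a)(h)`, the lower limit of the difference quotients for
`t ↓ 0` and `h' → h`. -/
def subderiv2 {E : Type*} [NormedAddCommGroup E] [InnerProductSpace ℝ E] (θ : E → EReal)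
    (x a h : E) : EReal :=
  liminf (fun p : ℝ × E => diffQuot2 θ x a p.1 p.2) (𝓝[>] (0 : ℝ) ×ˢ 𝓝 h)

/-- `θ` is twice epi-differentiable at `x` for `a`: the second-order difference quotients
epi-converge as `t ↓ 0`. -/
def TwiceEpiDiff {E : Type*} [NormedAddCommGroup E] [InnerProductSpace ℝ E] (θ : E → EReal)
    (x a : E) : Prop :=
  ∃ g : E → EReal, ∀ t : ℕ → ℝ, (∀ k, 0 < t k) → Tendsto t atTop (𝓝 0) →
    EpiConverges (fun k => diffQuot2 θ x a (t k)) g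

/-- `q` is generalized quadratic: a quadratic form with symmetric matrix on a linear subspace, and
`+∞` off that subspace. -/
def IsGenQuadratic {E : Type*} [NormedAddCommGroup E] [InnerProductSpace ℝ E]
    (q : E → EReal) : Prop :=
  ∃ (A : E →L[ℝ] E) (L : Submodule ℝ E), (∀ u w, inner ℝ (A u) w = inner ℝ u (A w)) ∧
    ∀ w, q w = ((inner ℝ w (A w) : ℝ) : EReal) + indicatorFun (L : Set E) w

/-! ### Decomposable functions -/

/-- `φ` is `C^ℓ`-decomposable at `x₀` with decomposition pair `(σ_C, F)`. -/
structure IsDecomposable {n m : ℕ} (ℓ : ℕ) (φ : EuclideanSpace ℝ (Fin n) → EReal)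
    (C : Set (EuclideanSpace ℝ (Fin m)))
    (F : EuclideanSpace ℝ (Fin n) → EuclideanSpace ℝ (Fin m))
    (x₀ : EuclideanSpace ℝ (Fin n)) : Prop where
  mem_dom : φ x₀ ≠ ⊤
  closed : IsClosed C
  convex : Convex ℝ C
  nonempty : C.Nonempty
  map_zero : F x₀ = 0
  local_eq : ∃ U : Set (EuclideanSpace ℝ (Fin n)), IsOpen U ∧ x₀ ∈ U ∧
    ContDiffOn ℝ ℓ F U ∧ ∀ x ∈ U, φ x = φ x₀ + supportFun C (F x)
  /-- Robinson's constraint qualification. -/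
  robinson : (0 : EuclideanSpace ℝ (Fin m)) ∈
    interior {y | ∃ h z, supportFun C z ≠ ⊤ ∧ y = F x₀ + fderiv ℝ F x₀ h - z}

/-- `φ` is `C^ℓ`-strictly decomposable at `x₀` for `l₀` with decomposition pair `(σ_C, F)`:
in addition, `DF(x₀) ℝⁿ - N_C(l₀) = ℝᵐ`. -/
structure IsStrictlyDecomposable {n m : ℕ} (ℓ : ℕ) (φ : EuclideanSpace ℝ (Fin n) → EReal)
    (C : Set (EuclideanSpace ℝ (Fin m)))
    (F : EuclideanSpace ℝ (Fin n) → EuclideanSpace ℝ (Fin m))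
    (x₀ : EuclideanSpace ℝ (Fin n)) (l₀ : EuclideanSpace ℝ (Fin m)) : Prop
    extends IsDecomposable ℓ φ C F x₀ where
  mem : l₀ ∈ C
  strict : {y | ∃ h, ∃ z ∈ normalCone C l₀, y = fderiv ℝ F x₀ h - z} = Set.univ

/-- `DF(x)ᵀ l`. -/
def adjDeriv {n m : ℕ} (F : EuclideanSpace ℝ (Fin n) → EuclideanSpace ℝ (Fin m))
    (x : EuclideanSpace ℝ (Fin n)) (l : EuclideanSpace ℝ (Fin m)) : EuclideanSpace ℝ (Fin n) :=
  ContinuousLinearMap.adjoint (fderiv ℝ F x) l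

/-- `H(x, l) = ∑ i, l i ∇²F_i(x)`, as a linear operator. -/
def hessOp {n m : ℕ} (F : EuclideanSpace ℝ (Fin n) → EuclideanSpace ℝ (Fin m))
    (x : EuclideanSpace ℝ (Fin n)) (l : EuclideanSpace ℝ (Fin m)) :
    EuclideanSpace ℝ (Fin n) →L[ℝ] EuclideanSpace ℝ (Fin n) :=
  ∑ i, l i • fderiv ℝ (gradient fun y => F y i) x

/-- The cone `S = DF(x)⁻¹ N_C(l)`. -/
def critCone {n m : ℕ} (C : Set (EuclideanSpace ℝ (Fin m)))
    (F : EuclideanSpace ℝ (Fin n) → EuclideanSpace ℝ (Fin m))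
    (x : EuclideanSpace ℝ (Fin n)) (l : EuclideanSpace ℝ (Fin m)) :
    Set (EuclideanSpace ℝ (Fin n)) :=
  fderiv ℝ F x ⁻¹' normalCone C l

/-- `Q = Π_A H(x, l) Π_A` with `A = aff S`, `S = DF(x)⁻¹ N_C(l)`. As `0 ∈ S`, the affine hull `A` is
a linear subspace and coincides with its direction. -/
def critOp {n m : ℕ} (C : Set (EuclideanSpace ℝ (Fin m)))
    (F : EuclideanSpace ℝ (Fin n) → EuclideanSpace ℝ (Fin m))
    (x : EuclideanSpace ℝ (Fin n)) (l : EuclideanSpace ℝ (Fin m)) :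
    EuclideanSpace ℝ (Fin n) →L[ℝ] EuclideanSpace ℝ (Fin n) :=
  (affineSpan ℝ (critCone C F x l)).direction.starProjection ∘L hessOp F x l ∘L
    (affineSpan ℝ (critCone C F x l)).direction.starProjection

/-- The outer second-order tangent path property of `C` at `l₀`. The distance is extended-valued,
so that the distance to the empty set is infinite. -/
def HasOTP {E : Type*} [NormedAddCommGroup E] [InnerProductSpace ℝ E] (C : Set E) (l₀ : E) :
    Prop :=
  ∃ M : ℝ, 0 < M ∧ ∃ V ∈ 𝓝 l₀, ∃ L : E → Submodule ℝ E,
    (∀ l ∈ C ∩ V, (L l : Set E) ⊆ lineality (tangentCone C l)) ∧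
    (∀ s : ℕ → E, (∀ k, s k ∈ C ∩ V) → Tendsto s atTop (𝓝 l₀) →
      SetConverges (fun k => (L (s k) : Set E)) (lineality (tangentCone C l₀))) ∧
    ∀ l ∈ C ∩ V, ∀ p ∈ L l, ‖p‖ = 1 →
      Metric.infEDist 0 (outerTangent2 C l p) < ENNReal.ofReal M

/-- Uniform lower bound for the second subderivatives of `φ` near `(x₀, v₀)`, with quadratic part `Q`
and cone `S`: along every sequence
`(x k, v k) → (x₀, v₀)` in the graph of `∂φ` such that `φ` is twice epi-differentiable at `x k` for
`v k` with generalized quadratic second subderivative, the lower epi-limit of the second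
subderivatives is bounded below by `⟨w, Q w⟩ + ι_{aff S}(w)`. -/
def HasSubderivLowerBound {E : Type*} [NormedAddCommGroup E] [InnerProductSpace ℝ E] (φ : E → EReal)
    (x₀ v₀ : E) (Q : E →L[ℝ] E) (S : Set E) : Prop :=
  ∀ x v : ℕ → E, (∀ k, v k ∈ subdiff φ (x k)) →
    Tendsto x atTop (𝓝 x₀) → Tendsto v atTop (𝓝 v₀) →
    (∀ k, TwiceEpiDiff φ (x k) (v k)) → (∀ k, IsGenQuadratic (subderiv2 φ (x k) (v k))) →
    ∀ w, ((inner ℝ w (Q w) : ℝ) : EReal) + indicatorFun (affineSpan ℝ S : Set E) w ≤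
      epiLiminf (fun k => subderiv2 φ (x k) (v k)) w

end SecondOrderVar

end

/-!
Near `x₀` one has `φ = φ x₀ + σ_C ∘ F`, and a subgradient of `σ_C` at `y` is a point `l ∈ C` with
`y ∈ N_C(l)`. If such an `l` at `y = F x` admits points `l + t p + (t² / 2) u_t ∈ C` along some
`t ↓ 0` with `u_t → u`, then inserting them as competitors into the supremum defining
`σ_C (F (x + t h))`, and using `⟨p, F x⟩ = 0` for `p` in the lineality space of `T_C(l)`, gives
`d²φ(x | DF(x)ᵀ l)(w) ≥ ⟨w, H(x, l) w⟩ + 2 ⟨p, DF(x) w⟩ + ⟨u, F x⟩`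
(`coe_le_subderiv2_of_mem_outerTangent2`). Twice epi-differentiability enters here: the competitors
exist along one sequence of steps only, and the epi-limit can be computed along that sequence.

Along the given sequences `F (x k) → 0`, while `u` can be chosen with `‖u‖ ≤ M ‖p‖²`; so the last
term disappears in the limit and the lower epi-limit at `w` is at least
`⟨w, H w⟩ + 2 ⟨p, DF(x₀) w⟩` for every `p` in the linear space `lin T_C(l₀)`. Taking `p = 0` gives the
quadratic part. As `lin T_C(l₀)` is the orthogonal complement of `N_C(l₀)`, and as strictness makes
`DF(x₀)⁻¹ (span N_C(l₀))` equal to the affine hull of `DF(x₀)⁻¹ N_C(l₀)`, any `w` off this hull has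
`⟨p, DF(x₀) w⟩ ≠ 0` for some `p`, and scaling `p` yields the value `+∞`
(`le_epiLiminf_subderiv2`).

Strictness also says that `DF(x₀)ᵀ` has no kernel on the polar cone of `N_C(l₀)`, which contains
`C - l₀`; by compactness `‖DF(x)ᵀ (c - l₀)‖ ≥ δ ‖c - l₀‖` for `c ∈ C` and `x` near `x₀`
(`exists_norm_sub_le_adjoint`). Hence multipliers are bounded and converge to `l₀`.

For the second statement, multipliers are produced by the chain rule `∂φ(x) ⊆ DF(x)ᵀ ∂σ_C(F x)`
(`exists_multiplier_of_mem_subdiff`): a regular subgradient inequality at `x` is a minimality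
property, which is perturbed by replacing `σ_C` with its smooth Moreau envelopes; the optimality
conditions of the perturbed problems furnish approximate multipliers, and these subconverge by the
uniform bound.
-/

namespace SecondOrderVar

/-! ### Support functions and normal cones -/

section Convex

variable {E : Type*} [NormedAddCommGroup E] [InnerProductSpace ℝ E] {C : Set E}

theorem inner_le_supportFun {c : E} (hc : c ∈ C) (y : E) :
    ((inner ℝ c y : ℝ) : EReal) ≤ supportFun C y :=
  le_iSup₂ (f := fun l (_ : l ∈ C) => ((inner ℝ l y : ℝ) : EReal)) c hc

theorem supportFun_le_coe_iff {y : E} {r : ℝ} :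
    supportFun C y ≤ (r : EReal) ↔ ∀ c ∈ C, inner ℝ c y ≤ r := by
  simp [supportFun, iSup_le_iff]

theorem supportFun_eq_of_mem_normalCone {l y : E} (hl : l ∈ C) (hy : y ∈ normalCone C l) :
    supportFun C y = ((inner ℝ l y : ℝ) : EReal) := by
  refine le_antisymm (supportFun_le_coe_iff.2 fun c hc => ?_) (inner_le_supportFun hl y)
  have := hy c hc
  rw [inner_sub_right] at this
  rw [real_inner_comm y c, real_inner_comm y l]
  linarith

theorem mem_of_forall_inner_le_supportFun [CompleteSpace E] (hcl : IsClosed C) (hcv : Convex ℝ C)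
    {u : E} (h : ∀ y, ((inner ℝ u y : ℝ) : EReal) ≤ supportFun C y) : u ∈ C := by
  by_contra hu
  obtain ⟨f, s, hf, hfu⟩ := geometric_hahn_banach_closed_point hcv hcl hu
  set y := (InnerProductSpace.toDual ℝ E).symm f
  have key : ∀ z, inner ℝ z y = f z := fun z => by
    rw [real_inner_comm]; exact InnerProductSpace.toDual_symm_apply
  have h1 := (h y).trans (supportFun_le_coe_iff.2 fun c hc => (key c).trans_le (hf c hc).le)
  rw [EReal.coe_le_coe_iff, key] at h1
  linarith

theorem zero_mem_normalCone (C : Set E) (l : E) : (0 : E) ∈ normalCone C l := by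
  intro y _; simp

theorem add_mem_normalCone {l v w : E} (hv : v ∈ normalCone C l) (hw : w ∈ normalCone C l) :
    v + w ∈ normalCone C l := by
  intro y hy
  rw [inner_add_left]
  linarith [hv y hy, hw y hy]

theorem smul_mem_normalCone {l v : E} (hv : v ∈ normalCone C l) {r : ℝ} (hr : 0 ≤ r) :
    r • v ∈ normalCone C l := by
  intro y hy
  rw [real_inner_smul_left]
  exact mul_nonpos_of_nonneg_of_nonpos hr (hv y hy)

/-- The graph of the normal cone mapping is closed. -/
theorem mem_normalCone_of_tendsto {l v : E} {l' v' : ℕ → E} (hl : Tendsto l' atTop (𝓝 l))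
    (hv : Tendsto v' atTop (𝓝 v)) (h : ∀ k, v' k ∈ normalCone C (l' k)) : v ∈ normalCone C l :=
  fun y hy => le_of_tendsto (hv.inner (tendsto_const_nhds.sub hl)) (.of_forall fun k => h k y hy)

/-- A first-order consequence of the regular subgradient inequality along a ray on which `θ` has
at most linear growth. -/
theorem inner_le_of_mem_regularSubdiff {θ : E → EReal} {y u τ : E} {s r : ℝ}
    (hu : u ∈ regularSubdiff θ y) (hs : θ y = s)
    (h : ∀ t : ℝ, 0 < t → t < 1 → θ (y + t • τ) ≤ ((s + t * r : ℝ) : EReal)) :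
    inner ℝ u τ ≤ r := by
  have main : ∀ ε : ℝ, 0 < ε → inner ℝ u τ - ε * ‖τ‖ ≤ r := by
    intro ε hε
    have hlim : Tendsto (fun t : ℝ => y + t • τ) (𝓝[>] 0) (𝓝 y) := by
      have : Continuous fun t : ℝ => y + t • τ := by fun_prop
      simpa using (this.tendsto 0).mono_left (nhdsWithin_le_nhds (s := Set.Ioi 0))
    obtain ⟨t, ht, h01⟩ := ((hlim.eventually (hu.2 ε hε)).and
      (Ioo_mem_nhdsGT (zero_lt_one (α := ℝ)))).exists
    have h2 := ht.trans (h t h01.1 h01.2)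
    rw [hs, ← EReal.coe_add, EReal.coe_le_coe_iff, add_sub_cancel_left, inner_smul_right, norm_smul,
      Real.norm_of_nonneg h01.1.le] at h2
    have h3 : t * (inner ℝ u τ - ε * ‖τ‖) ≤ t * r := by linarith
    exact le_of_mul_le_mul_left h3 h01.1
  have hlim : Tendsto (fun ε : ℝ => inner ℝ u τ - ε * ‖τ‖) (𝓝[>] 0) (𝓝 (inner ℝ u τ)) := by
    have : Continuous fun ε : ℝ => inner ℝ u τ - ε * ‖τ‖ := by fun_prop
    simpa using (this.tendsto 0).mono_left (nhdsWithin_le_nhds (s := Set.Ioi 0))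
  exact le_of_tendsto hlim (eventually_nhdsWithin_of_forall main)

theorem exists_supportFun_eq_coe (hne : C.Nonempty) {y : E} (h : supportFun C y ≠ ⊤) :
    ∃ s : ℝ, supportFun C y = s := by
  obtain ⟨c, hc⟩ := hne
  have hbot : supportFun C y ≠ ⊥ := fun hb => by
    have := inner_le_supportFun hc y
    rw [hb, le_bot_iff] at this
    exact EReal.coe_ne_bot _ this
  exact ⟨_, (EReal.coe_toReal h hbot).symm⟩

/-- Sublinearity of `σ_C` turns the local subgradient inequality into `⟨u, ·⟩ ≤ σ_C` (direction `τ`)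
and `σ_C y ≤ ⟨u, y⟩` (direction `-y`). -/
theorem mem_normalCone_of_mem_regularSubdiff_supportFun [CompleteSpace E] (hcl : IsClosed C)
    (hcv : Convex ℝ C) (hne : C.Nonempty) {y u : E} (hu : u ∈ regularSubdiff (supportFun C) y) :
    u ∈ C ∧ y ∈ normalCone C u := by
  obtain ⟨s, hs⟩ := exists_supportFun_eq_coe hne hu.1
  have hs' := supportFun_le_coe_iff.1 hs.le
  constructor
  · refine mem_of_forall_inner_le_supportFun hcl hcv fun τ => ?_
    by_cases hτ : supportFun C τ = ⊤
    · simp [hτ]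
    obtain ⟨r, hr⟩ := exists_supportFun_eq_coe hne hτ
    have hr' := supportFun_le_coe_iff.1 hr.le
    rw [hr, EReal.coe_le_coe_iff]
    refine inner_le_of_mem_regularSubdiff hu hs fun t ht _ => supportFun_le_coe_iff.2 fun c hc => ?_
    rw [inner_add_right, inner_smul_right]
    have := mul_le_mul_of_nonneg_left (hr' c hc) ht.le
    linarith [hs' c hc]
  · have h1 : inner ℝ u (-y) ≤ -s := by
      refine inner_le_of_mem_regularSubdiff hu hs fun t ht ht1 =>
        supportFun_le_coe_iff.2 fun c hc => ?_
      rw [inner_add_right, inner_smul_right, inner_neg_right]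
      have := mul_le_mul_of_nonneg_left (hs' c hc) (sub_nonneg.2 ht1.le)
      linarith
    intro c hc
    rw [inner_neg_right] at h1
    rw [inner_sub_right, real_inner_comm c, real_inner_comm u]
    linarith [hs' c hc]

theorem mem_normalCone_of_mem_subdiff_supportFun [CompleteSpace E] (hcl : IsClosed C)
    (hcv : Convex ℝ C) (hne : C.Nonempty) {y u : E} (hu : u ∈ subdiff (supportFun C) y) :
    u ∈ C ∧ y ∈ normalCone C u := by
  obtain ⟨-, y', u', hy, -, hmem, hu'⟩ := hu
  have h := fun k => mem_normalCone_of_mem_regularSubdiff_supportFun hcl hcv hne (hmem k)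
  exact ⟨hcl.mem_of_tendsto hu' (.of_forall fun k => (h k).1),
    mem_normalCone_of_tendsto hu' hy fun k => (h k).2⟩

/-! ### Tangent cones and their lineality spaces -/

theorem inner_nonpos_of_mem_normalCone_of_mem_tangentCone {x v q : E} (hv : v ∈ normalCone C x)
    (hq : q ∈ tangentCone C x) : inner ℝ v q ≤ 0 := by
  obtain ⟨t, u, ht, -, hu, hmem⟩ := hq
  refine le_of_tendsto (tendsto_const_nhds.inner hu) (.of_forall fun k => ?_)
  have := hv _ (hmem k)
  rw [add_sub_cancel_left, inner_smul_right] at this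
  exact nonpos_of_mul_nonpos_right this (ht k)

/-- The tangent cone of a convex set is the polar of its normal cone: a point outside the closure of
the cone generated by `C - x` is separated from it by a normal vector. -/
theorem mem_tangentCone_iff [CompleteSpace E] (hcv : Convex ℝ C) {x : E} (hx : x ∈ C) {q : E} :
    q ∈ tangentCone C x ↔ ∀ v ∈ normalCone C x, inner ℝ v q ≤ 0 := by
  refine ⟨fun hq v hv => inner_nonpos_of_mem_normalCone_of_mem_tangentCone hv hq, fun h => ?_⟩
  let K : Set E := {z | ∃ s : ℝ, 0 ≤ s ∧ ∃ c ∈ C, z = s • (c - x)}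
  have hKcv : Convex ℝ K := by
    rintro _ ⟨s₁, hs₁, c₁, hc₁, rfl⟩ _ ⟨s₂, hs₂, c₂, hc₂, rfl⟩ a b ha hb -
    have ha' : 0 ≤ a * s₁ := by positivity
    have hb' : 0 ≤ b * s₂ := by positivity
    rcases (add_nonneg ha' hb').eq_or_lt with h0 | h0
    · have h1 : a * s₁ = 0 := by linarith
      have h2 : b * s₂ = 0 := by linarith
      exact ⟨0, le_rfl, x, hx, by simp [smul_smul, h1, h2]⟩
    · refine ⟨a * s₁ + b * s₂, h0.le, (a * s₁ / (a * s₁ + b * s₂)) • c₁ +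
        (b * s₂ / (a * s₁ + b * s₂)) • c₂, hcv hc₁ hc₂ (by positivity) (by positivity)
        (by field_simp), ?_⟩
      rw [smul_sub (a * s₁ + b * s₂), smul_add (a * s₁ + b * s₂), smul_smul (a * s₁ + b * s₂),
        smul_smul (a * s₁ + b * s₂), mul_div_cancel₀ _ h0.ne', mul_div_cancel₀ _ h0.ne']
      module
  have hq : q ∈ closure K := by
    by_contra hq
    obtain ⟨f, s, hf, hfq⟩ := geometric_hahn_banach_closed_point hKcv.closure isClosed_closure hq
    set v := (InnerProductSpace.toDual ℝ E).symm f
    have key : ∀ z, inner ℝ v z = f z := fun z => InnerProductSpace.toDual_symm_apply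
    have hs : 0 < s := by simpa using hf 0 (subset_closure ⟨0, le_rfl, x, hx, by simp⟩)
    have hv : v ∈ normalCone C x := by
      intro c hc
      by_contra! hpos
      have := hf _ (subset_closure ⟨s / inner ℝ v (c - x), by positivity, c, hc, rfl⟩)
      rw [map_smul, ← key, smul_eq_mul, div_mul_cancel₀ _ hpos.ne'] at this
      exact lt_irrefl _ this
    have := h v hv
    rw [key] at this
    linarith
  obtain ⟨z, hz, hzq⟩ := mem_closure_iff_seq_limit.1 hq
  choose s hs c hc hzc using hz
  -- The steps are small enough for `x + t_k s_k (c_k - x)` to lie on the segment from `x` to `c_k`.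
  refine ⟨fun k => 1 / ((k + 1 : ℝ) * (1 + s k)), z, fun k => ?_, ?_, hzq, fun k => ?_⟩
  · have := hs k; positivity
  · refine squeeze_zero (fun k => ?_) (fun k => ?_) tendsto_one_div_add_atTop_nhds_zero_nat
    · have := hs k; positivity
    · have := hs k
      refine one_div_le_one_div_of_le (by positivity) ?_
      nlinarith [k.cast_nonneg (α := ℝ)]
  · have h1 : (0 : ℝ) ≤ 1 / ((k + 1 : ℝ) * (1 + s k)) * s k := by have := hs k; positivity
    have h2 : 1 / ((k + 1 : ℝ) * (1 + s k)) * s k ≤ 1 := by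
      have := hs k
      rw [div_mul_eq_mul_div, one_mul, div_le_one (by positivity)]
      nlinarith [k.cast_nonneg (α := ℝ)]
    rw [hzc, smul_smul]
    exact hcv.add_smul_sub_mem hx (hc k) ⟨h1, h2⟩

theorem mem_lineality_tangentCone_iff [CompleteSpace E] (hcv : Convex ℝ C) {x : E} (hx : x ∈ C)
    {p : E} : p ∈ lineality (tangentCone C x) ↔ ∀ v ∈ normalCone C x, inner ℝ v p = 0 := by
  constructor
  · intro hp v hv
    have h0 : (0 : E) ∈ tangentCone C x := (mem_tangentCone_iff hcv hx).2 fun v _ => by simp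
    have h1 := inner_nonpos_of_mem_normalCone_of_mem_tangentCone hv (hp 0 h0 1)
    have h2 := inner_nonpos_of_mem_normalCone_of_mem_tangentCone hv (hp 0 h0 (-1))
    simp only [zero_add, one_smul, neg_smul, inner_neg_right] at h1 h2
    linarith
  · intro hp q hq t
    rw [mem_tangentCone_iff hcv hx] at hq ⊢
    intro v hv
    rw [inner_add_right, inner_smul_right, hp v hv]
    simpa using hq v hv

/-- The outer second-order tangent sets are positively homogeneous of degree two in the
direction. -/
theorem smul_mem_outerTangent2 {x h u : E} (hu : u ∈ outerTangent2 C x h) {r : ℝ} (hr : 0 < r) :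
    (r ^ 2) • u ∈ outerTangent2 C x (r • h) := by
  obtain ⟨t, u', ht, ht0, hu', hmem⟩ := hu
  refine ⟨fun k => t k / r, fun k => r ^ 2 • u' k, fun k => div_pos (ht k) hr,
    by simpa using ht0.div_const r, hu'.const_smul _, fun k => ?_⟩
  rw [smul_smul, smul_smul, div_mul_cancel₀ _ hr.ne']
  have : (t k / r) ^ 2 / 2 * r ^ 2 = t k ^ 2 / 2 := by field_simp
  rw [this]
  exact hmem k

/-- The distance bound for unit directions, extended to all directions by homogeneity. -/
theorem exists_mem_outerTangent2_norm_le {x : E} (hx : x ∈ C) {L : Submodule ℝ E} {M : ℝ}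
    (hM : ∀ p ∈ L, ‖p‖ = 1 → Metric.infEDist 0 (outerTangent2 C x p) < ENNReal.ofReal M)
    {p : E} (hp : p ∈ L) : ∃ u ∈ outerTangent2 C x p, ‖u‖ ≤ M * ‖p‖ ^ 2 := by
  rcases eq_or_ne p 0 with rfl | hp0
  · exact ⟨0, ⟨fun k => 1 / ((k : ℝ) + 1), fun _ => 0, fun k => by positivity,
      tendsto_one_div_add_atTop_nhds_zero_nat, tendsto_const_nhds, by simpa using hx⟩, by simp⟩
  · have hn : 0 < ‖p‖ := norm_pos_iff.2 hp0
    obtain ⟨u, hu, hlt⟩ := Metric.infEDist_lt_iff.1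
      (hM (‖p‖⁻¹ • p) (L.smul_mem _ hp)
        (by rw [norm_smul, norm_inv, norm_norm, inv_mul_cancel₀ hn.ne']))
    have hu' := smul_mem_outerTangent2 hu hn
    rw [smul_inv_smul₀ hn.ne'] at hu'
    refine ⟨_, hu', ?_⟩
    rw [edist_dist, ENNReal.ofReal_lt_ofReal_iff_of_nonneg dist_nonneg, dist_zero_left] at hlt
    rw [norm_smul, Real.norm_of_nonneg (by positivity), mul_comm]
    gcongr

end Convex

/-! ### The strict constraint qualification -/

section Strict

variable {E G : Type*} [NormedAddCommGroup E] [InnerProductSpace ℝ E]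
  [NormedAddCommGroup G] [InnerProductSpace ℝ G] {C : Set G} {l₀ : G} {A : E →L[ℝ] G}

theorem exists_sub_of_mem_span_normalCone {z : G}
    (hz : z ∈ Submodule.span ℝ (normalCone C l₀)) :
    ∃ z₁ ∈ normalCone C l₀, ∃ z₂ ∈ normalCone C l₀, z = z₁ - z₂ := by
  induction hz using Submodule.span_induction with
  | mem x hx => exact ⟨x, hx, 0, zero_mem_normalCone _ _, by simp⟩
  | zero => exact ⟨0, zero_mem_normalCone _ _, 0, zero_mem_normalCone _ _, by simp⟩
  | add x y _ _ hx hy =>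
    obtain ⟨x₁, hx₁, x₂, hx₂, rfl⟩ := hx
    obtain ⟨y₁, hy₁, y₂, hy₂, rfl⟩ := hy
    exact ⟨x₁ + y₁, add_mem_normalCone hx₁ hy₁, x₂ + y₂, add_mem_normalCone hx₂ hy₂, by abel⟩
  | smul a x _ hx =>
    obtain ⟨x₁, hx₁, x₂, hx₂, rfl⟩ := hx
    rcases le_total 0 a with ha | ha
    · exact ⟨_, smul_mem_normalCone hx₁ ha, _, smul_mem_normalCone hx₂ ha, smul_sub _ _ _⟩
    · exact ⟨_, smul_mem_normalCone hx₂ (neg_nonneg.2 ha), _,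
        smul_mem_normalCone hx₁ (neg_nonneg.2 ha), by module⟩

/-- Under the strict constraint qualification, taking linear hulls commutes with taking preimages
of the normal cone. -/
theorem mem_span_preimage_normalCone
    (hA : {y | ∃ h, ∃ z ∈ normalCone C l₀, y = A h - z} = Set.univ) {w : E}
    (hw : A w ∈ Submodule.span ℝ (normalCone C l₀)) :
    w ∈ Submodule.span ℝ (A ⁻¹' normalCone C l₀) := by
  obtain ⟨z₁, hz₁, z₂, hz₂, hz⟩ := exists_sub_of_mem_span_normalCone hw
  obtain ⟨h, z₃, hz₃, hh⟩ : z₂ ∈ {y | ∃ h, ∃ z ∈ normalCone C l₀, y = A h - z} := by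
    rw [hA]; trivial
  -- Both `h` and `w + h` lie in the preimage of the cone.
  have h1 : h ∈ A ⁻¹' normalCone C l₀ := by
    have : A h = z₂ + z₃ := by rw [hh]; abel
    rw [Set.mem_preimage, this]
    exact add_mem_normalCone hz₂ hz₃
  have h2 : w + h ∈ A ⁻¹' normalCone C l₀ := by
    have : A (w + h) = z₁ + z₃ := by rw [map_add, hz, hh]; abel
    rw [Set.mem_preimage, this]
    exact add_mem_normalCone hz₁ hz₃
  simpa using Submodule.sub_mem _ (Submodule.subset_span h2) (Submodule.subset_span h1)

/-- A vector not in the affine hull of the preimage of the normal cone is detected by the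
lineality space of the tangent cone. -/
theorem exists_mem_lineality_inner_ne_zero [CompleteSpace G] [FiniteDimensional ℝ G]
    (hcv : Convex ℝ C) (hl₀ : l₀ ∈ C)
    (hA : {y | ∃ h, ∃ z ∈ normalCone C l₀, y = A h - z} = Set.univ) {w : E}
    (hw : w ∉ affineSpan ℝ (A ⁻¹' normalCone C l₀)) :
    ∃ p ∈ lineality (tangentCone C l₀), inner ℝ p (A w) ≠ 0 := by
  by_contra! hcon
  refine hw ?_
  have h0 : (0 : E) ∈ A ⁻¹' normalCone C l₀ := by
    simpa using zero_mem_normalCone C l₀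
  have hspan : w ∈ Submodule.span ℝ (A ⁻¹' normalCone C l₀) := by
    apply mem_span_preimage_normalCone hA
    rw [← Submodule.orthogonal_orthogonal (Submodule.span ℝ (normalCone C l₀)),
      Submodule.mem_orthogonal]
    intro p hp
    refine hcon p ((mem_lineality_tangentCone_iff hcv hl₀).2 fun v hv => ?_)
    exact (Submodule.mem_orthogonal _ _).1 hp v (Submodule.subset_span hv)
  have := affineSpan_insert_zero (k := ℝ) (A ⁻¹' normalCone C l₀)
  rw [Set.insert_eq_of_mem h0] at this
  rw [← SetLike.mem_coe, this]
  exact hspan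

/-- Under the strict constraint qualification, the adjoint is bounded below on the polar of the
normal cone, hence on `C - l₀`; the bound persists for nearby operators. -/
theorem exists_norm_sub_le_adjoint [CompleteSpace E] [FiniteDimensional ℝ G]
    [CompleteSpace G]
    (hA : {y | ∃ h, ∃ z ∈ normalCone C l₀, y = A h - z} = Set.univ) :
    ∃ δ : ℝ, 0 < δ ∧ ∀ B : E →L[ℝ] G, ‖B - A‖ ≤ δ → ∀ c ∈ C,
      δ * ‖c - l₀‖ ≤ ‖ContinuousLinearMap.adjoint B (c - l₀)‖ := by
  obtain ⟨δ, hδ, h⟩ : ∃ δ : ℝ, 0 < δ ∧ ∀ d : G, ‖d‖ = 1 →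
      (∀ z ∈ normalCone C l₀, inner ℝ z d ≤ 0) → δ ≤ ‖ContinuousLinearMap.adjoint A d‖ := by
    let K : Set G := Metric.sphere 0 1 ∩ {d | ∀ z ∈ normalCone C l₀, inner ℝ z d ≤ 0}
    have hKcl : IsClosed {d : G | ∀ z ∈ normalCone C l₀, inner ℝ z d ≤ 0} := by
      simp only [Set.ofPred_forall]
      exact isClosed_biInter fun z _ => isClosed_le (by fun_prop) continuous_const
    have hK : IsCompact K := (isCompact_sphere 0 1).inter_right hKcl
    rcases K.eq_empty_or_nonempty with hem | hne
    · refine ⟨1, one_pos, fun d hd hz => ?_⟩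
      have : d ∈ K := ⟨by simpa using hd, hz⟩
      simp [hem] at this
    obtain ⟨d₀, hd₀, hmin⟩ := hK.exists_isMinOn hne
      (f := fun d => ‖ContinuousLinearMap.adjoint A d‖) (by fun_prop)
    refine ⟨_, norm_pos_iff.2 ?_, fun d hd hz => hmin ⟨by simpa using hd, hz⟩⟩
    intro h0
    obtain ⟨h, z, hz, hh⟩ : -d₀ ∈ {y | ∃ h, ∃ z ∈ normalCone C l₀, y = A h - z} := by
      rw [hA]; trivial
    have h1 : inner ℝ d₀ (-d₀) = inner ℝ (ContinuousLinearMap.adjoint A d₀) h - inner ℝ z d₀ := by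
      rw [hh, inner_sub_right, ContinuousLinearMap.adjoint_inner_left, real_inner_comm z d₀]
    rw [h0, inner_zero_left, inner_neg_right, real_inner_self_eq_norm_sq,
      mem_sphere_zero_iff_norm.1 hd₀.1] at h1
    linarith [hd₀.2 z hz]
  refine ⟨δ / 2, by positivity, fun B hB c hc => ?_⟩
  rcases eq_or_ne c l₀ with rfl | hne
  · simp
  have hn : 0 < ‖c - l₀‖ := norm_pos_iff.2 (sub_ne_zero.2 hne)
  have h1 := h (‖c - l₀‖⁻¹ • (c - l₀))
    (by rw [norm_smul, norm_inv, norm_norm, inv_mul_cancel₀ hn.ne'])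
    fun z hz => by
      rw [inner_smul_right]
      exact mul_nonpos_of_nonneg_of_nonpos (by positivity) (hz c hc)
  rw [map_smul, norm_smul, norm_inv, norm_norm, inv_mul_eq_div, le_div_iff₀ hn] at h1
  have h2 : ‖ContinuousLinearMap.adjoint A (c - l₀)‖ ≤
      ‖ContinuousLinearMap.adjoint B (c - l₀)‖ + δ / 2 * ‖c - l₀‖ := by
    have h3 : ContinuousLinearMap.adjoint A (c - l₀) = ContinuousLinearMap.adjoint B (c - l₀) -
        ContinuousLinearMap.adjoint (B - A) (c - l₀) := by
      simp only [map_sub, sub_apply]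
      abel
    rw [h3]
    refine (norm_sub_le _ _).trans (add_le_add le_rfl ?_)
    refine (ContinuousLinearMap.le_opNorm _ _).trans ?_
    rw [LinearIsometryEquiv.norm_map]
    gcongr
  linarith

end Strict

/-! ### A smooth regularization of the support function -/

section Envelope

variable {G : Type*} [NormedAddCommGroup G] [InnerProductSpace ℝ G] {C : Set G}

/-- `P` selects the maximizers over `C` of `c ↦ ⟨c, y⟩ - (τ / 2) ‖c‖²`, written as the variational
inequality that characterizes `P y` as the projection of `y / τ` onto `C`. -/
def IsProxSelection (C : Set G) (τ : ℝ) (P : G → G) : Prop :=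
  ∀ y, P y ∈ C ∧ ∀ c ∈ C, inner ℝ (y - τ • P y) (c - P y) ≤ 0

/-- The Moreau envelope `y ↦ max_{c ∈ C} (⟨c, y⟩ - (τ / 2) ‖c‖²)` of the support function, the
maximum being taken at `P y`. -/
noncomputable def envelope (τ : ℝ) (P : G → G) (y : G) : ℝ := inner ℝ (P y) y - τ / 2 * ‖P y‖ ^ 2

theorem exists_isProxSelection [CompleteSpace G] (hcl : IsClosed C) (hcv : Convex ℝ C)
    (hne : C.Nonempty) {τ : ℝ} (hτ : 0 < τ) : ∃ P, IsProxSelection C τ P := by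
  have h : ∀ y : G, ∃ μ ∈ C, ∀ c ∈ C, inner ℝ (y - τ • μ) (c - μ) ≤ 0 := by
    intro y
    obtain ⟨μ, hμ, hmin⟩ := exists_norm_eq_iInf_of_complete_convex hne hcl.isComplete hcv (τ⁻¹ • y)
    refine ⟨μ, hμ, fun c hc => ?_⟩
    have h1 := (norm_eq_iInf_iff_real_inner_le_zero hcv hμ).1 hmin c hc
    have h2 : y - τ • μ = τ • (τ⁻¹ • y - μ) := by rw [smul_sub, smul_inv_smul₀ hτ.ne']
    rw [h2, real_inner_smul_left]
    exact mul_nonpos_of_nonneg_of_nonpos hτ.le h1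
  choose P hP hP' using h
  exact ⟨P, fun y => ⟨hP y, hP' y⟩⟩

variable {τ : ℝ} {P : G → G}

theorem inner_sub_le_envelope (hτ : 0 < τ) (hP : IsProxSelection C τ P) {c : G} (hc : c ∈ C)
    (y : G) : inner ℝ c y - τ / 2 * ‖c‖ ^ 2 ≤ envelope τ P y := by
  have h1 := (hP y).2 c hc
  have h2 : 0 ≤ τ / 2 * ‖c - P y‖ ^ 2 := by positivity
  rw [norm_sub_sq_real, real_inner_comm] at h2
  rw [inner_sub_left, inner_sub_right, inner_sub_right, real_inner_smul_left, real_inner_smul_left,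
    real_inner_self_eq_norm_sq, real_inner_comm c y, real_inner_comm (P y) y] at h1
  unfold envelope
  linarith

theorem envelope_sub_le (hτ : 0 < τ) (hP : IsProxSelection C τ P) (y z : G) :
    envelope τ P z - envelope τ P y - inner ℝ (P y) (z - y) ≤ 1 / (2 * τ) * ‖z - y‖ ^ 2 := by
  have h1 := (hP y).2 (P z) (hP z).1
  set c := P z
  set μ := P y
  -- Young's inequality for `⟨c - μ, z - y⟩`
  have h2 : inner ℝ (c - μ) (z - y) ≤ τ / 2 * ‖c - μ‖ ^ 2 + 1 / (2 * τ) * ‖z - y‖ ^ 2 := by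
    have h3 : 0 ≤ 1 / (2 * τ) * ‖τ • (c - μ) - (z - y)‖ ^ 2 := by positivity
    rw [norm_sub_sq_real, norm_smul, Real.norm_of_nonneg hτ.le, real_inner_smul_left] at h3
    have h4 : 1 / (2 * τ) * ((τ * ‖c - μ‖) ^ 2 - 2 * (τ * inner ℝ (c - μ) (z - y)) +
        ‖z - y‖ ^ 2) = τ / 2 * ‖c - μ‖ ^ 2 - inner ℝ (c - μ) (z - y) +
          1 / (2 * τ) * ‖z - y‖ ^ 2 := by
      field_simp
    linarith
  rw [norm_sub_sq_real] at h2
  simp only [inner_sub_left, inner_sub_right, real_inner_smul_left, real_inner_self_eq_norm_sq]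
    at h1 h2 ⊢
  unfold envelope
  rw [show P z = c from rfl, show P y = μ from rfl]
  rw [real_inner_comm c y, real_inner_comm μ y] at h1
  rw [real_inner_comm c μ] at h1
  linarith

theorem le_envelope_sub (hτ : 0 < τ) (hP : IsProxSelection C τ P) (y z : G) :
    0 ≤ envelope τ P z - envelope τ P y - inner ℝ (P y) (z - y) := by
  have := inner_sub_le_envelope hτ hP (hP y).1 z
  rw [inner_sub_right]
  unfold envelope at *
  linarith

/-- The envelope lies between its tangents and quadratic perturbations of these. -/
theorem hasFDerivAt_envelope (hτ : 0 < τ) (hP : IsProxSelection C τ P) (y : G) :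
    HasFDerivAt (envelope τ P) (innerSL ℝ (P y)) y := by
  have h0 : (fun z => envelope τ P z - envelope τ P y - innerSL ℝ (P y) (z - y)) =O[𝓝 y]
      fun z => ‖z - y‖ ^ 2 := by
    refine .of_bound (1 / (2 * τ)) (.of_forall fun z => ?_)
    rw [innerSL_apply_apply, Real.norm_of_nonneg (le_envelope_sub hτ hP y z), norm_pow, norm_norm]
    exact envelope_sub_le hτ hP y z
  refine .of_isLittleO (h0.trans_isLittleO ?_)
  exact Asymptotics.isLittleO_norm_pow_id (one_lt_two) |>.comp_tendsto (tendsto_sub_nhds_zero_iff.2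
    tendsto_id)

end Envelope

/-! ### The chain rule for subgradients of decomposable functions -/

section ChainRule

variable {E G : Type*} [NormedAddCommGroup E] [InnerProductSpace ℝ E]
  [NormedAddCommGroup G] [InnerProductSpace ℝ G]

/-- The first-order condition at a local minimizer of `p + K ‖· - a‖`. -/
theorem norm_le_of_isLocalMin_add_norm {p : E → ℝ} {p' : E →L[ℝ] ℝ} {a : E} {K : ℝ} (hK : 0 ≤ K)
    (hp : HasFDerivAt p p' a) (hmin : ∀ᶠ x in 𝓝 a, p a ≤ p x + K * ‖x - a‖) : ‖p'‖ ≤ K := by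
  refine le_of_forall_pos_le_add fun η hη => ?_
  have h1 : ∀ᶠ x in 𝓝 a, -((K + η) * ‖x - a‖) ≤ p' (x - a) := by
    filter_upwards [hmin, hp.isLittleO.def hη] with x h2 h3
    have := (abs_le.1 (Real.norm_eq_abs _ ▸ h3)).2
    linarith
  have h2 : ∀ h : E, -((K + η) * ‖h‖) ≤ p' h := by
    intro h
    have hlim : Tendsto (fun t : ℝ => a + t • h) (𝓝[>] 0) (𝓝 a) := by
      have : Continuous fun t : ℝ => a + t • h := by fun_prop
      simpa using (this.tendsto 0).mono_left (nhdsWithin_le_nhds (s := Set.Ioi 0))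
    obtain ⟨t, ht, ht0⟩ := ((hlim.eventually h1).and self_mem_nhdsWithin).exists
    have ht0 : 0 < t := ht0
    rw [add_sub_cancel_left, norm_smul, map_smul, Real.norm_of_nonneg ht0.le, smul_eq_mul] at ht
    have : t * (-((K + η) * ‖h‖)) ≤ t * p' h := by linarith
    exact le_of_mul_le_mul_left this ht0
  refine ContinuousLinearMap.opNorm_le_bound _ (by positivity) fun h => ?_
  rw [Real.norm_eq_abs, abs_le]
  refine ⟨h2 h, ?_⟩
  have := h2 (-h)
  rw [norm_neg, map_neg] at this
  linarith

theorem tendsto_adjoint_apply [CompleteSpace E] [CompleteSpace G] {ι : Type*} {l : Filter ι}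
    {A : ι → E →L[ℝ] G} {A₀ : E →L[ℝ] G} (hA : Tendsto A l (𝓝 A₀)) {μ : ι → G} {μ₀ : G}
    (hμ : Tendsto μ l (𝓝 μ₀)) :
    Tendsto (fun j => ContinuousLinearMap.adjoint (A j) (μ j)) l
      (𝓝 (ContinuousLinearMap.adjoint A₀ μ₀)) := by
  have h1 : Continuous fun q : (E →L[ℝ] G) × G => ContinuousLinearMap.adjoint q.1 q.2 := by
    have := (ContinuousLinearMap.adjoint (𝕜 := ℝ) (E := E) (F := G)).continuous
    fun_prop
  have h2 := (h1.tendsto (A₀, μ₀)).comp (hA.prodMk_nhds hμ)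
  simpa only [Function.comp_def] using h2

variable [CompleteSpace E] [FiniteDimensional ℝ G] [CompleteSpace G]
  {C : Set G} {l₀ : G} {F : E → G}

/-- Multipliers with bounded images under the adjoint derivatives subconverge. -/
theorem exists_tendsto_multiplier (hcl : IsClosed C) {x : E} (hcont : ContinuousAt (fderiv ℝ F) x)
    {δ : ℝ} (hδ : 0 < δ) (hbd : ∀ᶠ y in 𝓝 x, ∀ c ∈ C,
      δ * ‖c - l₀‖ ≤ ‖ContinuousLinearMap.adjoint (fderiv ℝ F y) (c - l₀)‖)
    {y : ℕ → E} (hy : Tendsto y atTop (𝓝 x)) {μ : ℕ → G} (hμ : ∀ j, μ j ∈ C) {R : ℝ}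
    (hR : ∀ᶠ j in atTop, ‖ContinuousLinearMap.adjoint (fderiv ℝ F (y j)) (μ j)‖ ≤ R) :
    ∃ μ₀ ∈ C, ∃ s : ℕ → ℕ, StrictMono s ∧ Tendsto (μ ∘ s) atTop (𝓝 μ₀) := by
  have hn : ∀ᶠ z in 𝓝 x, ‖fderiv ℝ F z‖ < ‖fderiv ℝ F x‖ + 1 :=
    hcont.norm.eventually_lt continuousAt_const (by simp)
  obtain ⟨N, hN⟩ := eventually_atTop.1 (hR.and (hy.eventually (hbd.and hn)))
  have hb : ∀ j, μ (j + N) ∈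
      Metric.closedBall l₀ (δ⁻¹ * (R + (‖fderiv ℝ F x‖ + 1) * ‖l₀‖)) := by
    intro j
    obtain ⟨h1, h2, h3⟩ := hN (j + N) (by omega)
    rw [mem_closedBall_iff_norm, inv_mul_eq_div, le_div_iff₀ hδ, mul_comm]
    refine (h2 _ (hμ _)).trans ?_
    rw [map_sub]
    refine (norm_sub_le _ _).trans (add_le_add h1 ?_)
    refine (ContinuousLinearMap.le_opNorm _ _).trans ?_
    rw [LinearIsometryEquiv.norm_map]
    gcongr
  have := FiniteDimensional.proper ℝ G
  obtain ⟨μ₀, -, s, hs, hlim⟩ := (isCompact_closedBall l₀ _).tendsto_subseq hb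
  refine ⟨μ₀, hcl.mem_of_tendsto hlim (.of_forall fun j => hμ _), fun j => s j + N,
    fun i j hij => Nat.add_lt_add_right (hs hij) N, hlim⟩

/-- Approximate chain rule: if `x` minimizes, locally and in a weak sense,
`σ_C ∘ F - ⟨u, ·⟩ + ε ‖· - x‖`, then `u` is `2 ε`-close to some `DF(x)ᵀ μ` with `μ ∈ C` and
`F x ∈ N_C(μ)`. The multiplier arises by minimizing the problem with `σ_C` replaced by its
envelopes, which are smooth and increase to `σ_C` as `τ ↓ 0`. -/
theorem exists_multiplier_of_eventually_le [FiniteDimensional ℝ E] (hcl : IsClosed C)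
    (hcv : Convex ℝ C) (hne : C.Nonempty) {x : E} (hdiff : ∀ᶠ y in 𝓝 x, DifferentiableAt ℝ F y)
    (hcont : ContinuousAt (fderiv ℝ F) x) {δ : ℝ} (hδ : 0 < δ) (hbd : ∀ᶠ y in 𝓝 x, ∀ c ∈ C,
      δ * ‖c - l₀‖ ≤ ‖ContinuousLinearMap.adjoint (fderiv ℝ F y) (c - l₀)‖)
    {s ε : ℝ} (hε : 0 < ε) {u : E} (hs : ∀ c ∈ C, inner ℝ c (F x) ≤ s)
    (hreg : ∀ᶠ y in 𝓝 x, ∀ b : ℝ, (∀ c ∈ C, inner ℝ c (F y) ≤ b) →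
      s + inner ℝ u (y - x) - ε * ‖y - x‖ ≤ b) :
    ∃ μ ∈ C, F x ∈ normalCone C μ ∧
      ‖ContinuousLinearMap.adjoint (fderiv ℝ F x) μ - u‖ ≤ 2 * ε := by
  obtain ⟨r, hr, hball⟩ := Metric.nhds_basis_closedBall.eventually_iff.1 (hdiff.and hreg)
  have := FiniteDimensional.proper ℝ E
  let τ : ℕ → ℝ := fun j => 1 / ((j : ℝ) + 1)
  have hτ : ∀ j, 0 < τ j := fun j => by positivity
  have hτ0 : Tendsto τ atTop (𝓝 0) := tendsto_one_div_add_atTop_nhds_zero_nat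
  choose P hP using fun j => exists_isProxSelection hcl hcv hne (hτ j)
  let f : ℕ → E → ℝ := fun j y =>
    envelope (τ j) (P j) (F y) - inner ℝ u (y - x) + 2 * ε * ‖y - x‖
  have hFc : ContinuousOn F (Metric.closedBall x r) := fun y hy =>
    (hball hy).1.continuousAt.continuousWithinAt
  have hfc : ∀ j, ContinuousOn (f j) (Metric.closedBall x r) := by
    intro j
    have henv : Continuous (envelope (τ j) (P j)) := continuous_iff_continuousAt.2 fun y =>
      (hasFDerivAt_envelope (hτ j) (hP j) y).continuousAt
    have h1 := henv.comp_continuousOn hFc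
    have h2 : Continuous fun y : E => inner ℝ u (y - x) := by fun_prop
    have h3 : Continuous fun y : E => 2 * ε * ‖y - x‖ := by fun_prop
    exact (h1.sub h2.continuousOn).add h3.continuousOn
  choose y hy hmin using fun j => (isCompact_closedBall x r).exists_isMinOn
    ⟨x, Metric.mem_closedBall_self hr.le⟩ (hfc j)
  obtain ⟨z, hz, a, ha, hyz⟩ := (isCompact_closedBall x r).tendsto_subseq hy
  have hFyz : Tendsto (fun j => F (y (a j))) atTop (𝓝 (F z)) :=
    ((hball hz).1.continuousAt.tendsto).comp hyz
  have hτa : Tendsto (fun j => τ (a j)) atTop (𝓝 0) := hτ0.comp ha.tendsto_atTop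
  -- The minimizers converge to `x`, by the subgradient inequality at their limit.
  have hzx : z = x := by
    have h1 : ∀ c ∈ C, inner ℝ c (F z) ≤ s + inner ℝ u (z - x) - 2 * ε * ‖z - x‖ := by
      intro c hc
      have h2 : ∀ j, inner ℝ c (F (y (a j))) - τ (a j) / 2 * ‖c‖ ^ 2 -
          inner ℝ u (y (a j) - x) + 2 * ε * ‖y (a j) - x‖ ≤ s := by
        intro j
        have h3 : f (a j) (y (a j)) ≤ f (a j) x := hmin (a j) (Metric.mem_closedBall_self hr.le)
        have h4 : f (a j) x ≤ s := by
          have := hs _ (hP (a j) (F x)).1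
          have h5 : 0 ≤ τ (a j) / 2 * ‖P (a j) (F x)‖ ^ 2 := by have := hτ (a j); positivity
          simp only [f, envelope, sub_self, inner_zero_right, norm_zero, mul_zero]
          linarith
        have h6 := inner_sub_le_envelope (hτ (a j)) (hP (a j)) hc (F (y (a j)))
        simp only [f] at h3 h4
        linarith
      have h3 : Tendsto (fun j => inner ℝ c (F (y (a j))) - τ (a j) / 2 * ‖c‖ ^ 2 -
          inner ℝ u (y (a j) - x) + 2 * ε * ‖y (a j) - x‖) atTop
          (𝓝 (inner ℝ c (F z) - 0 / 2 * ‖c‖ ^ 2 - inner ℝ u (z - x) + 2 * ε * ‖z - x‖)) :=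
        (((tendsto_const_nhds.inner hFyz).sub ((hτa.div_const 2).mul_const _)).sub
          (tendsto_const_nhds.inner (hyz.sub_const x))).add ((hyz.sub_const x).norm.const_mul _)
      have := le_of_tendsto h3 (.of_forall h2)
      linarith
    have h2 := (hball hz).2 _ h1
    have h3 : ε * ‖z - x‖ ≤ 0 := by linarith
    have h4 : ‖z - x‖ = 0 := le_antisymm (nonpos_of_mul_nonpos_right h3 hε) (norm_nonneg _)
    exact sub_eq_zero.1 (norm_eq_zero.1 h4)
  subst hzx
  let μ : ℕ → G := fun j => P (a j) (F (y (a j)))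
  have hfo : ∀ᶠ j in atTop,
      ‖ContinuousLinearMap.adjoint (fderiv ℝ F (y (a j))) (μ j) - u‖ ≤ 2 * ε := by
    filter_upwards [hyz.eventually (Metric.ball_mem_nhds z hr)] with j hj
    have hd : HasFDerivAt (fun x' => envelope (τ (a j)) (P (a j)) (F x') - inner ℝ u (x' - z))
        ((innerSL ℝ (μ j)).comp (fderiv ℝ F (y (a j))) - innerSL ℝ u) (y (a j)) := by
      have h1 := (hasFDerivAt_envelope (hτ (a j)) (hP (a j)) (F (y (a j)))).comp (y (a j))
        (hball (hy (a j))).1.hasFDerivAt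
      have h2 : HasFDerivAt (fun x' => inner ℝ u (x' - z)) (innerSL ℝ u) (y (a j)) := by
        exact (innerSL ℝ u).hasFDerivAt.comp (y (a j)) ((hasFDerivAt_id (y (a j))).sub_const z)
      exact h1.sub h2
    have h3 := norm_le_of_isLocalMin_add_norm (K := 2 * ε) (by positivity) hd (by
      filter_upwards [Metric.isOpen_ball.mem_nhds hj] with x' hx'
      have h4 : f (a j) (y (a j)) ≤ f (a j) x' := hmin (a j) (Metric.ball_subset_closedBall hx')
      have h5 : ‖x' - z‖ ≤ ‖x' - y (a j)‖ + ‖y (a j) - z‖ := norm_sub_le_norm_sub_add_norm_sub _ _ _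
      have h6 := mul_le_mul_of_nonneg_left h5 (by positivity : 0 ≤ 2 * ε)
      simp only [f] at h4
      linarith)
    have h4 : (innerSL ℝ (μ j)).comp (fderiv ℝ F (y (a j))) - innerSL ℝ u =
        innerSL ℝ (ContinuousLinearMap.adjoint (fderiv ℝ F (y (a j))) (μ j) - u) := by
      ext h
      simp [ContinuousLinearMap.adjoint_inner_left]
    rwa [h4, innerSL_apply_norm] at h3
  obtain ⟨μ₀, hμ₀, b, hb, hlim⟩ := exists_tendsto_multiplier hcl hcont hδ hbd hyz
    (μ := μ) (fun j => (hP _ _).1) (R := 2 * ε + ‖u‖) (by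
      filter_upwards [hfo] with j hj
      have := norm_add_le (ContinuousLinearMap.adjoint (fderiv ℝ F (y (a j))) (μ j) - u) u
      rw [sub_add_cancel] at this
      exact this.trans (by gcongr))
  refine ⟨μ₀, hμ₀, fun c hc => ?_, ?_⟩
  · have h1 : ∀ j, inner ℝ (F (y (a (b j))) - τ (a (b j)) • μ (b j)) (c - μ (b j)) ≤ 0 :=
      fun j => (hP _ _).2 c hc
    have h2 : Tendsto (fun j => inner ℝ (F (y (a (b j))) - τ (a (b j)) • μ (b j)) (c - μ (b j)))
        atTop (𝓝 (inner ℝ (F z - (0 : ℝ) • μ₀) (c - μ₀))) :=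
      ((hFyz.comp hb.tendsto_atTop).sub ((hτa.comp hb.tendsto_atTop).smul hlim)).inner
        (tendsto_const_nhds.sub hlim)
    simpa using le_of_tendsto h2 (.of_forall h1)
  · have h1 := tendsto_adjoint_apply (hcont.tendsto.comp (hyz.comp hb.tendsto_atTop)) hlim
    exact le_of_tendsto (h1.sub_const u).norm (hb.tendsto_atTop.eventually hfo)

/-- The chain rule `∂φ(x) ⊆ DF(x)ᵀ ∂σ_C(F x)` for a function that agrees with `r + σ_C ∘ F`
near `x`. -/
theorem exists_multiplier_of_mem_subdiff [FiniteDimensional ℝ E] (hcl : IsClosed C)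
    (hcv : Convex ℝ C) (hne : C.Nonempty) {φ : E → EReal} {r₀ : ℝ} {U : Set E} (hU : IsOpen U)
    (hφ : ∀ y ∈ U, φ y = r₀ + supportFun C (F y))
    (hdiff : ∀ y ∈ U, DifferentiableAt ℝ F y) (hcont : ContinuousOn (fderiv ℝ F) U)
    {δ : ℝ} (hδ : 0 < δ) (hbd : ∀ y ∈ U, ∀ c ∈ C,
      δ * ‖c - l₀‖ ≤ ‖ContinuousLinearMap.adjoint (fderiv ℝ F y) (c - l₀)‖)
    {x v : E} (hx : x ∈ U) (hv : v ∈ subdiff φ x) :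
    ∃ μ ∈ C, F x ∈ normalCone C μ ∧ v = ContinuousLinearMap.adjoint (fderiv ℝ F x) μ := by
  have approx : ∀ y ∈ U, ∀ u ∈ regularSubdiff φ y, ∀ ε : ℝ, 0 < ε → ∃ μ ∈ C,
      F y ∈ normalCone C μ ∧ ‖ContinuousLinearMap.adjoint (fderiv ℝ F y) μ - u‖ ≤ 2 * ε := by
    intro y hy u hu ε hε
    have hyU : U ∈ 𝓝 y := hU.mem_nhds hy
    have hfin : supportFun C (F y) ≠ ⊤ := by
      intro htop
      have := hu.1
      rw [hφ y hy, htop, EReal.add_top_of_ne_bot (EReal.coe_ne_bot _)] at this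
      exact this rfl
    obtain ⟨s, hs⟩ := exists_supportFun_eq_coe hne hfin
    refine exists_multiplier_of_eventually_le hcl hcv hne (by filter_upwards [hyU] using hdiff)
      (hcont.continuousAt hyU) hδ (by filter_upwards [hyU] using hbd) hε
      (supportFun_le_coe_iff.1 hs.le) ?_
    filter_upwards [hyU, hu.2 ε hε] with z hz h1 b hb
    rw [hφ y hy, hφ z hz, hs] at h1
    have h2 := h1.trans (add_le_add_right (supportFun_le_coe_iff.2 hb) _)
    rw [← EReal.coe_add, ← EReal.coe_add, ← EReal.coe_add, EReal.coe_le_coe_iff] at h2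
    linarith
  obtain ⟨-, y, u, hy, -, hu, huv⟩ := hv
  obtain ⟨N, hN⟩ := eventually_atTop.1 (hy.eventually (hU.mem_nhds hx))
  have hy' := hy.comp (tendsto_add_atTop_nat N)
  have hu' := huv.comp (tendsto_add_atTop_nat N)
  choose μ hμ hnc hle using fun j : ℕ => approx (y (j + N)) (hN _ (by omega)) _ (hu (j + N))
    (1 / ((j : ℝ) + 1)) (by positivity)
  have hcx := hcont.continuousAt (hU.mem_nhds hx)
  have hdiff0 : Tendsto (fun j => ContinuousLinearMap.adjoint (fderiv ℝ F (y (j + N))) (μ j))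
      atTop (𝓝 v) := by
    have h1 : Tendsto (fun j => ContinuousLinearMap.adjoint (fderiv ℝ F (y (j + N))) (μ j) -
        u (j + N)) atTop (𝓝 0) := by
      refine squeeze_zero_norm hle ?_
      simpa using tendsto_one_div_add_atTop_nhds_zero_nat.const_mul (2 : ℝ)
    simpa using h1.add hu'
  obtain ⟨μ₀, hμ₀, s, hs, hlim⟩ := exists_tendsto_multiplier hcl hcx hδ
    (by filter_upwards [hU.mem_nhds hx] using hbd) hy' hμ (R := ‖v‖ + 1)
    ((hdiff0.norm.eventually_lt tendsto_const_nhds (by simp)).mono fun _ h => le_of_lt h)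
  refine ⟨μ₀, hμ₀, mem_normalCone_of_tendsto hlim
    ((hdiff x hx).continuousAt.tendsto.comp (hy'.comp hs.tendsto_atTop)) fun j => hnc _, ?_⟩
  exact tendsto_nhds_unique (hdiff0.comp hs.tendsto_atTop)
    (tendsto_adjoint_apply (hcx.tendsto.comp (hy'.comp hs.tendsto_atTop)) hlim)

end ChainRule

/-! ### Second-order expansions -/

section Taylor

variable {E : Type*} [NormedAddCommGroup E] [InnerProductSpace ℝ E]

/-- Second-order Taylor expansion of a function whose gradient `γ` is differentiable at `x`. -/
theorem taylor_two_isLittleO {g : E → ℝ} {γ : E → E} {H : E →L[ℝ] E} {x : E}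
    (hg : ∀ᶠ y in 𝓝 x, HasFDerivAt g (innerSL ℝ (γ y)) y) (hγ : HasFDerivAt γ H x) :
    (fun y => g y - g x - inner ℝ (γ x) (y - x) - inner ℝ (H (y - x)) (y - x) / 2) =o[𝓝 x]
      fun y => ‖y - x‖ ^ 2 := by
  refine Asymptotics.isLittleO_iff.2 fun ε hε => ?_
  obtain ⟨r, hr, hball⟩ := Metric.eventually_nhds_iff_ball.1 (hg.and (hγ.isLittleO.def hε))
  filter_upwards [Metric.ball_mem_nhds x hr] with y hy
  set k := y - x
  have hmem : ∀ s ∈ Set.Icc (0 : ℝ) 1, x + s • k ∈ Metric.ball x r := fun s hs =>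
    (convex_ball x r).add_smul_sub_mem (Metric.mem_ball_self hr) hy hs
  have hder : ∀ s ∈ Set.Icc (0 : ℝ) 1, HasDerivWithinAt
      (fun s : ℝ => g (x + s • k) - s * inner ℝ (γ x) k - s ^ 2 / 2 * inner ℝ (H k) k)
      (inner ℝ (γ (x + s • k) - γ x - H (s • k)) k) (Set.Icc 0 1) s := by
    intro s hs
    have h1 : HasDerivAt (fun s : ℝ => x + s • k) k s := by
      simpa using ((hasDerivAt_id s).smul_const k).const_add x
    have h2 := (hball _ (hmem s hs)).1.comp_hasDerivAt s h1
    have h3 := (hasDerivAt_id s).mul_const (inner ℝ (γ x) k)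
    have h4 := (((hasDerivAt_id s).pow 2).div_const 2).mul_const (inner ℝ (H k) k)
    refine ((h2.sub h3).sub h4).hasDerivWithinAt.congr_deriv ?_
    simp only [innerSL_apply_apply, id, inner_sub_left, map_smul, real_inner_smul_left]
    ring
  have hbound : ∀ s ∈ Set.Ico (0 : ℝ) 1,
      ‖inner ℝ (γ (x + s • k) - γ x - H (s • k)) k‖ ≤ ε * ‖k‖ ^ 2 := by
    intro s hs
    have h1 := (hball _ (hmem s ⟨hs.1, hs.2.le⟩)).2
    rw [add_sub_cancel_left, norm_smul, Real.norm_of_nonneg hs.1] at h1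
    calc ‖inner ℝ (γ (x + s • k) - γ x - H (s • k)) k‖
        ≤ ‖γ (x + s • k) - γ x - H (s • k)‖ * ‖k‖ := norm_inner_le_norm _ _
      _ ≤ (ε * (1 * ‖k‖)) * ‖k‖ := by
        gcongr
        exact h1.trans (by gcongr; exact hs.2.le)
      _ = ε * ‖k‖ ^ 2 := by ring
  have h := norm_image_sub_le_of_norm_deriv_le_segment_01' hder hbound
  have hxk : x + k = y := add_sub_cancel x y
  simp only [one_smul, zero_smul, add_zero, hxk] at h
  rw [norm_pow, norm_norm]
  refine (congrArg norm ?_).trans_le h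
  ring

theorem tendsto_second_quotient {g : E → ℝ} {γ : E → E} {H : E →L[ℝ] E} {x : E}
    (hg : ∀ᶠ y in 𝓝 x, HasFDerivAt g (innerSL ℝ (γ y)) y) (hγ : HasFDerivAt γ H x)
    {t : ℕ → ℝ} (ht : ∀ k, 0 < t k) (ht0 : Tendsto t atTop (𝓝 0)) {h : ℕ → E} {w : E}
    (hh : Tendsto h atTop (𝓝 w)) :
    Tendsto (fun k => (g (x + t k • h k) - g x - t k * inner ℝ (γ x) (h k)) / (t k ^ 2 / 2)) atTop
      (𝓝 (inner ℝ (H w) w)) := by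
  have hlim : Tendsto (fun k => x + t k • h k) atTop (𝓝 x) := by
    simpa using (ht0.smul hh).const_add x
  have h1 := (taylor_two_isLittleO hg hγ).comp_tendsto hlim
  have h2 : (fun k => ‖x + t k • h k - x‖ ^ 2) =O[atTop] fun k => t k ^ 2 := by
    have h3 : (fun k => ‖h k‖ ^ 2) =O[atTop] fun _ => (1 : ℝ) := (hh.norm.pow 2).isBigO_one ℝ
    have h4 := (Asymptotics.isBigO_refl (fun k => t k ^ 2) atTop).mul h3
    refine h4.congr (fun k => ?_) fun k => mul_one _
    rw [add_sub_cancel_left, norm_smul, Real.norm_of_nonneg (ht k).le]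
    ring
  have h3 := ((h1.trans_isBigO h2).tendsto_div_nhds_zero).const_mul 2
  have h4 : Tendsto (fun k => inner ℝ (H (h k)) (h k)) atTop (𝓝 (inner ℝ (H w) w)) :=
    ((H.continuous.tendsto w).comp hh).inner hh
  have h5 := h3.add h4
  rw [mul_zero, zero_add] at h5
  refine h5.congr fun k => ?_
  have := (ht k).ne'
  simp only [Function.comp_apply, add_sub_cancel_left, map_smul, real_inner_smul_left,
    inner_smul_right]
  field_simp
  ring

end Taylor

section Hessian

variable {n m : ℕ} {F : EuclideanSpace ℝ (Fin n) → EuclideanSpace ℝ (Fin m)}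
  {U : Set (EuclideanSpace ℝ (Fin n))}

theorem contDiffOn_gradient_coord (hU : IsOpen U) (hF : ContDiffOn ℝ 2 F U) (i : Fin m) :
    ContDiffOn ℝ 1 (gradient fun y => F y i) U := by
  have h1 : ContDiffOn ℝ 2 (fun y => F y i) U :=
    (EuclideanSpace.proj (𝕜 := ℝ) i).contDiff.comp_contDiffOn hF
  have h2 : ContDiffOn ℝ 1 (fderiv ℝ fun y => F y i) U := h1.fderiv_of_isOpen hU (by norm_num)
  exact (InnerProductSpace.toDual ℝ (EuclideanSpace ℝ (Fin n))).symm.contDiff.comp_contDiffOn h2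

theorem adjDeriv_eq_sum {x : EuclideanSpace ℝ (Fin n)} (hF : DifferentiableAt ℝ F x)
    (l : EuclideanSpace ℝ (Fin m)) :
    adjDeriv F x l = ∑ i, l i • gradient (fun y => F y i) x := by
  refine ext_inner_right ℝ fun h => ?_
  have h1 : ∀ i, inner ℝ (gradient (fun y => F y i) x) h = fderiv ℝ F x h i := by
    intro i
    have h2 := ((EuclideanSpace.proj (𝕜 := ℝ) i).hasFDerivAt.comp x hF.hasFDerivAt).fderiv
    have h3 : fderiv ℝ (fun y => F y i) x =
        (EuclideanSpace.proj (𝕜 := ℝ) i).comp (fderiv ℝ F x) := h2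
    rw [gradient, InnerProductSpace.toDual_symm_apply, h3]
    rfl
  rw [adjDeriv, ContinuousLinearMap.adjoint_inner_left, sum_inner, PiLp.inner_apply]
  refine Finset.sum_congr rfl fun i _ => ?_
  rw [real_inner_smul_left, h1]
  simp [mul_comm]

/-- `H(x, l)` is the derivative at `x` of the gradient `y ↦ DF(y)ᵀ l` of `⟨l, F⟩`. -/
theorem hasFDerivAt_adjDeriv (hU : IsOpen U) (hF : ContDiffOn ℝ 2 F U)
    {x : EuclideanSpace ℝ (Fin n)} (hx : x ∈ U) (l : EuclideanSpace ℝ (Fin m)) :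
    HasFDerivAt (fun y => adjDeriv F y l) (hessOp F x l) x := by
  have hUx := hU.mem_nhds hx
  have h1 : HasFDerivAt (fun y => ∑ i, l i • gradient (fun z => F z i) y) (hessOp F x l) x :=
    HasFDerivAt.fun_sum fun i _ =>
      ((((contDiffOn_gradient_coord hU hF i).contDiffAt hUx).differentiableAt
        one_ne_zero).hasFDerivAt).const_smul (l i)
  refine h1.congr_of_eventuallyEq ?_
  filter_upwards [hUx] with y hy
  exact adjDeriv_eq_sum ((hF.contDiffAt (hU.mem_nhds hy)).differentiableAt two_ne_zero) l

theorem hasFDerivAt_inner_comp {x : EuclideanSpace ℝ (Fin n)} (hF : DifferentiableAt ℝ F x)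
    (l : EuclideanSpace ℝ (Fin m)) :
    HasFDerivAt (fun y => inner ℝ l (F y)) (innerSL ℝ (adjDeriv F x l)) x := by
  have h1 := (innerSL ℝ l).hasFDerivAt.comp x hF.hasFDerivAt
  have h2 : (innerSL ℝ l).comp (fderiv ℝ F x) = innerSL ℝ (adjDeriv F x l) := by
    ext h
    simp [adjDeriv, ContinuousLinearMap.adjoint_inner_left]
  rw [h2] at h1
  exact h1

theorem tendsto_hessOp (hU : IsOpen U) (hF : ContDiffOn ℝ 2 F U) {ι : Type*} {a : Filter ι}
    {x₀ : EuclideanSpace ℝ (Fin n)} (hx₀ : x₀ ∈ U) {l₀ : EuclideanSpace ℝ (Fin m)}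
    {x : ι → EuclideanSpace ℝ (Fin n)} {l : ι → EuclideanSpace ℝ (Fin m)}
    (hx : Tendsto x a (𝓝 x₀)) (hl : Tendsto l a (𝓝 l₀)) :
    Tendsto (fun k => hessOp F (x k) (l k)) a (𝓝 (hessOp F x₀ l₀)) := by
  refine tendsto_finsetSum _ fun i _ => ?_
  have h1 : ContinuousAt (fderiv ℝ (gradient fun y => F y i)) x₀ :=
    ((contDiffOn_gradient_coord hU hF i).continuousOn_fderiv_of_isOpen hU le_rfl).continuousAt
      (hU.mem_nhds hx₀)
  exact ((((EuclideanSpace.proj (𝕜 := ℝ) i).continuous.tendsto l₀).comp hl)).smul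
    (h1.tendsto.comp hx)

end Hessian

/-! ### Lower bounds for second subderivatives -/

section Subderivative

variable {E : Type*} [NormedAddCommGroup E] [InnerProductSpace ℝ E]

/-- An epi-limit of the second-order difference quotients along all step sequences lies below the
second subderivative. -/
theorem le_subderiv2_of_epiConverges {θ : E → EReal} {x a : E} {g : E → EReal}
    (hg : ∀ t : ℕ → ℝ, (∀ k, 0 < t k) → Tendsto t atTop (𝓝 0) →
      EpiConverges (fun k => diffQuot2 θ x a (t k)) g) (w : E) :
    g w ≤ subderiv2 θ x a w := by
  refine le_of_forall_lt fun b hb => ?_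
  obtain ⟨c, hbc, hcg⟩ := exists_between hb
  refine hbc.trans_le (le_liminf_of_le (by isBoundedDefault) ?_)
  by_contra hcon
  have hfr : ∃ᶠ p : ℝ × E in 𝓝[>] (0 : ℝ) ×ˢ 𝓝 w, diffQuot2 θ x a p.1 p.2 ≤ c ∧ 0 < p.1 := by
    refine Frequently.and_eventually ((not_eventually.1 hcon).mono fun p hp => (not_le.1 hp).le) ?_
    exact tendsto_fst.eventually (self_mem_nhdsWithin : ∀ᶠ t : ℝ in 𝓝[>] 0, 0 < t)
  obtain ⟨q, hq, hq'⟩ := exists_seq_forall_of_frequently hfr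
  have h1 : Tendsto (fun k => (q k).1) atTop (𝓝 0) :=
    (tendsto_fst.comp hq).mono_right nhdsWithin_le_nhds
  have h2 : Tendsto (fun k => (q k).2) atTop (𝓝 w) := tendsto_snd.comp hq
  have h3 := (hg _ (fun k => (hq' k).2) h1 w).1 _ h2
  have h4 : liminf (fun k => diffQuot2 θ x a (q k).1 (q k).2) atTop ≤ c :=
    (liminf_le_liminf (.of_forall fun k => (hq' k).1)).trans_eq (liminf_const c)
  exact (h3.trans h4).not_gt hcg

theorem coe_le_diffQuot2 {θ : E → EReal} {x a h : E} {t s r : ℝ} (ht : 0 < t) (hs : θ x = s)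
    (hr : (r : EReal) ≤ θ (x + t • h)) :
    (((r - s - t * inner ℝ a h) / (t ^ 2 / 2) : ℝ) : EReal) ≤ diffQuot2 θ x a t h := by
  have ht2 : (0 : ℝ) < t ^ 2 / 2 := by positivity
  unfold diffQuot2
  rw [EReal.le_div_iff_mul_le (by exact_mod_cast ht2) (EReal.coe_ne_top _), ← EReal.coe_mul,
    div_mul_cancel₀ _ ht2.ne', hs, EReal.coe_sub, EReal.coe_sub]
  exact EReal.sub_le_sub (EReal.sub_le_sub hr le_rfl) le_rfl

/-- For a twice epi-differentiable function, lower bounds for the second subderivative need to be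
verified along a single step sequence only. -/
theorem TwiceEpiDiff.coe_le_subderiv2 {θ : E → EReal} {x a : E} (hθ : TwiceEpiDiff θ x a)
    {t : ℕ → ℝ} (ht : ∀ k, 0 < t k) (ht0 : Tendsto t atTop (𝓝 0)) {w : E} {B : ℝ}
    (hB : ∀ h : ℕ → E, Tendsto h atTop (𝓝 w) → ∃ b : ℕ → ℝ, Tendsto b atTop (𝓝 B) ∧
      ∀ᶠ k in atTop, (b k : EReal) ≤ diffQuot2 θ x a (t k) (h k)) :
    (B : EReal) ≤ subderiv2 θ x a w := by
  obtain ⟨g, hg⟩ := hθ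
  refine le_trans ?_ (le_subderiv2_of_epiConverges hg w)
  obtain ⟨h, hh, hle⟩ := (hg t ht ht0 w).2
  obtain ⟨b, hb, hbd⟩ := hB h hh
  have h1 : Tendsto (fun k => (b k : EReal)) atTop (𝓝 (B : EReal)) :=
    (continuous_coe_real_ereal.tendsto B).comp hb
  rw [← h1.limsup_eq]
  exact (limsup_le_limsup hbd).trans hle

end Subderivative

/-- The basic estimate. Second-order tangent paths `l + t p + (t² / 2) u` in `C` provide competitors
in the supremum that defines `σ_C(F(x + t h))`. -/
theorem coe_le_subderiv2_of_mem_outerTangent2 {n m : ℕ} {φ : EuclideanSpace ℝ (Fin n) → EReal}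
    {C : Set (EuclideanSpace ℝ (Fin m))} {F : EuclideanSpace ℝ (Fin n) → EuclideanSpace ℝ (Fin m)}
    {U : Set (EuclideanSpace ℝ (Fin n))} (hU : IsOpen U) (hF : ContDiffOn ℝ 2 F U) {r₀ : ℝ}
    (hφ : ∀ y ∈ U, φ y = r₀ + supportFun C (F y)) {x : EuclideanSpace ℝ (Fin n)} (hx : x ∈ U)
    {l p u : EuclideanSpace ℝ (Fin m)} (hl : l ∈ C) (hN : F x ∈ normalCone C l)
    (hp : inner ℝ p (F x) = 0) (hu : u ∈ outerTangent2 C l p)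
    (hepi : TwiceEpiDiff φ x (adjDeriv F x l)) (w : EuclideanSpace ℝ (Fin n)) :
    ((inner ℝ (hessOp F x l w) w + 2 * inner ℝ p (fderiv ℝ F x w) + inner ℝ u (F x) : ℝ) : EReal) ≤
      subderiv2 φ x (adjDeriv F x l) w := by
  obtain ⟨t, u', ht, ht0, hu', hmem⟩ := hu
  have hdiff : ∀ y ∈ U, DifferentiableAt ℝ F y := fun y hy =>
    (hF.contDiffAt (hU.mem_nhds hy)).differentiableAt two_ne_zero
  have hUx := hU.mem_nhds hx
  refine hepi.coe_le_subderiv2 ht ht0 fun h hh => ?_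
  have hy : Tendsto (fun k => x + t k • h k) atTop (𝓝 x) := by
    simpa using (ht0.smul hh).const_add x
  have hgrad : ∀ q : EuclideanSpace ℝ (Fin m), ∀ᶠ y in 𝓝 x,
      HasFDerivAt (fun y => inner ℝ q (F y)) (innerSL ℝ (adjDeriv F y q)) y := fun q => by
    filter_upwards [hUx] with y hy using hasFDerivAt_inner_comp (hdiff y hy) q
  have hquot := fun q =>
    tendsto_second_quotient (hgrad q) (hasFDerivAt_adjDeriv hU hF hx q) ht ht0 hh
  have hFy : Tendsto (fun k => F (x + t k • h k)) atTop (𝓝 (F x)) :=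
    (hdiff x hx).continuousAt.tendsto.comp hy
  have hlin : Tendsto (fun k => inner ℝ p (F (x + t k • h k)) / t k) atTop
      (𝓝 (inner ℝ p (fderiv ℝ F x w))) := by
    -- The second-order quotient of `⟨p, F⟩` converges, which is more than needed here.
    have h1 := (tendsto_const_nhds (x := adjDeriv F x p)).inner hh |>.add
      ((ht0.div_const 2).mul (hquot p))
    rw [zero_div, zero_mul, add_zero, adjDeriv, ContinuousLinearMap.adjoint_inner_left] at h1
    refine h1.congr fun k => ?_
    have := (ht k).ne'
    rw [hp]
    field_simp
    ring
  refine ⟨fun k => (r₀ + inner ℝ (l + t k • p + (t k ^ 2 / 2) • u' k) (F (x + t k • h k)) -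
    (r₀ + inner ℝ l (F x)) - t k * inner ℝ (adjDeriv F x l) (h k)) / (t k ^ 2 / 2), ?_, ?_⟩
  · refine (((hquot l).add (hlin.const_mul 2)).add (hu'.inner hFy)).congr fun k => ?_
    have := (ht k).ne'
    rw [inner_add_left, inner_add_left, real_inner_smul_left, real_inner_smul_left]
    field_simp
    ring
  · filter_upwards [hy.eventually hUx] with k hk
    refine coe_le_diffQuot2 (ht k) ?_ ?_
    · rw [hφ x hx, supportFun_eq_of_mem_normalCone hl hN, EReal.coe_add]
    · rw [hφ _ hk, EReal.coe_add]
      exact add_le_add_right (inner_le_supportFun (hmem k) _) _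

/-! ### Lower epi-limits along sequences of multipliers -/

section EpiLimit

variable {E : Type*} [TopologicalSpace E]

theorem coe_le_epiLiminf {θ : ℕ → E → EReal} {b : ℕ → E → ℝ} {w : E} {B : ℝ}
    (hle : ∀ᶠ k in atTop, ∀ z, (b k z : EReal) ≤ θ k z)
    (hb : Tendsto (fun q : ℕ × E => b q.1 q.2) (atTop ×ˢ 𝓝 w) (𝓝 B)) :
    (B : EReal) ≤ epiLiminf θ w := by
  have h1 : Tendsto (fun q : ℕ × E => (b q.1 q.2 : EReal)) (atTop ×ˢ 𝓝 w) (𝓝 (B : EReal)) :=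
    (continuous_coe_real_ereal.tendsto B).comp hb
  rw [← h1.liminf_eq]
  exact liminf_le_liminf ((tendsto_fst.eventually hle).mono fun q hq => hq q.2)

theorem epiLiminf_comp_add (θ : ℕ → E → EReal) (N : ℕ) (w : E) :
    epiLiminf (fun k => θ (k + N)) w = epiLiminf θ w := by
  have h : map (Prod.map (fun k => k + N) id) (atTop ×ˢ 𝓝 w) = (atTop : Filter ℕ) ×ˢ 𝓝 w := by
    rw [← prod_map_map_eq', map_add_atTop_eq_nat, map_id]
  unfold epiLiminf
  conv_rhs => rw [← h]
  rfl

end EpiLimit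

theorem tendsto_clm_apply {ι E G : Type*} [NormedAddCommGroup E] [NormedSpace ℝ E]
    [NormedAddCommGroup G] [NormedSpace ℝ G] {a : Filter ι} {A : ι → E →L[ℝ] G} {A₀ : E →L[ℝ] G}
    (hA : Tendsto A a (𝓝 A₀)) {z : ι → E} {z₀ : E} (hz : Tendsto z a (𝓝 z₀)) :
    Tendsto (fun j => A j (z j)) a (𝓝 (A₀ z₀)) := by
  have h1 : Continuous fun q : (E →L[ℝ] G) × E => q.1 q.2 := by fun_prop
  have h2 := (h1.tendsto (A₀, z₀)).comp (hA.prodMk_nhds hz)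
  simpa only [Function.comp_def] using h2

section Decomposable

variable {n m : ℕ} {φ : EuclideanSpace ℝ (Fin n) → EReal} {C : Set (EuclideanSpace ℝ (Fin m))}
  {F : EuclideanSpace ℝ (Fin n) → EuclideanSpace ℝ (Fin m)} {x₀ : EuclideanSpace ℝ (Fin n)}
  {l₀ : EuclideanSpace ℝ (Fin m)}

/-- On a suitable neighborhood of `x₀`, a strictly decomposable function has its representation,
and the adjoint derivatives are bounded below on `C - l₀` uniformly. -/
theorem IsStrictlyDecomposable.exists_nhd (h : IsStrictlyDecomposable 2 φ C F x₀ l₀)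
    (hφ : φ x₀ ≠ ⊥) :
    ∃ (U : Set (EuclideanSpace ℝ (Fin n))) (r₀ δ : ℝ), IsOpen U ∧ x₀ ∈ U ∧ ContDiffOn ℝ 2 F U ∧
      (∀ y ∈ U, φ y = r₀ + supportFun C (F y)) ∧ 0 < δ ∧ ∀ y ∈ U, ∀ c ∈ C,
        δ * ‖c - l₀‖ ≤ ‖ContinuousLinearMap.adjoint (fderiv ℝ F y) (c - l₀)‖ := by
  obtain ⟨U, hU, hx₀, hF, heq⟩ := h.local_eq
  obtain ⟨δ, hδ, hB⟩ := exists_norm_sub_le_adjoint h.strict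
  have hcont : ContinuousOn (fderiv ℝ F) U := hF.continuousOn_fderiv_of_isOpen hU (by norm_num)
  refine ⟨U ∩ fderiv ℝ F ⁻¹' Metric.ball (fderiv ℝ F x₀) δ, (φ x₀).toReal, δ,
    hcont.isOpen_inter_preimage hU Metric.isOpen_ball, ⟨hx₀, Metric.mem_ball_self hδ⟩,
    hF.mono Set.inter_subset_left, fun y hy => ?_, hδ, fun y hy => hB _ ?_⟩
  · rw [EReal.coe_toReal h.mem_dom hφ]
    exact heq y hy.1
  · exact (mem_ball_iff_norm.1 hy.2).le

/-- Convergence of the subgradients `DF(x k)ᵀ l k` forces convergence of the multipliers. -/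
theorem tendsto_multiplier {x : ℕ → EuclideanSpace ℝ (Fin n)}
    {l : ℕ → EuclideanSpace ℝ (Fin m)} {δ : ℝ} (hδ : 0 < δ)
    (hcont : ContinuousAt (fderiv ℝ F) x₀) (hx : Tendsto x atTop (𝓝 x₀))
    (hv : Tendsto (fun k => adjDeriv F (x k) (l k)) atTop (𝓝 (adjDeriv F x₀ l₀)))
    (hbd : ∀ᶠ k in atTop,
      δ * ‖l k - l₀‖ ≤ ‖ContinuousLinearMap.adjoint (fderiv ℝ F (x k)) (l k - l₀)‖) :
    Tendsto l atTop (𝓝 l₀) := by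
  have h1 : Tendsto (fun k => adjDeriv F (x k) l₀) atTop (𝓝 (adjDeriv F x₀ l₀)) :=
    tendsto_adjoint_apply (hcont.tendsto.comp hx) tendsto_const_nhds
  have h2 := ((hv.sub h1).norm.const_mul δ⁻¹)
  rw [sub_self, norm_zero, mul_zero] at h2
  refine tendsto_iff_norm_sub_tendsto_zero.2
    (squeeze_zero' (.of_forall fun _ => norm_nonneg _) ?_ h2)
  filter_upwards [hbd] with k hk
  rw [inv_mul_eq_div, le_div_iff₀ hδ, mul_comm]
  simpa only [adjDeriv, map_sub] using hk

/-- The lower bound for the second subderivatives along a sequence of points and multipliers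
`F (x k) ∈ N_C(l k)`. For `p_k ∈ L_k` converging to `p`, second-order tangent vectors of length
at most `M ‖p_k‖²` contribute `O(‖F (x k)‖) → 0`, which leaves `⟨w, H w⟩ + 2 ⟨p, DF(x₀) w⟩`; off
the affine hull of the critical cone this is unbounded over the subspace of all `p`. -/
theorem le_epiLiminf_subderiv2 (hdec : IsStrictlyDecomposable 2 φ C F x₀ l₀) (hφ : φ x₀ ≠ ⊥)
    {x : ℕ → EuclideanSpace ℝ (Fin n)} {l : ℕ → EuclideanSpace ℝ (Fin m)}
    {L : ℕ → Submodule ℝ (EuclideanSpace ℝ (Fin m))} {M : ℝ} (hx : Tendsto x atTop (𝓝 x₀))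
    (hv : Tendsto (fun k => adjDeriv F (x k) (l k)) atTop (𝓝 (adjDeriv F x₀ l₀)))
    (hepi : ∀ k, TwiceEpiDiff φ (x k) (adjDeriv F (x k) (l k)))
    (hl : ∀ k, l k ∈ C) (hN : ∀ k, F (x k) ∈ normalCone C (l k))
    (hL : ∀ k, (L k : Set (EuclideanSpace ℝ (Fin m))) ⊆ lineality (tangentCone C (l k)))
    (hlim : lineality (tangentCone C l₀) ⊆
      setLiminf fun k => (L k : Set (EuclideanSpace ℝ (Fin m))))
    (hM : ∀ k, ∀ p ∈ L k, ‖p‖ = 1 →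
      Metric.infEDist 0 (outerTangent2 C (l k) p) < ENNReal.ofReal M)
    (w : EuclideanSpace ℝ (Fin n)) :
    ((inner ℝ w (hessOp F x₀ l₀ w) : ℝ) : EReal) +
        indicatorFun (affineSpan ℝ (critCone C F x₀ l₀) : Set (EuclideanSpace ℝ (Fin n))) w ≤
      epiLiminf (fun k => subderiv2 φ (x k) (adjDeriv F (x k) (l k))) w := by
  obtain ⟨U, r₀, δ, hU, hx₀, hF, hrep, hδ, hbd⟩ := hdec.exists_nhd hφ
  have hUx := hU.mem_nhds hx₀
  have hcont : ContinuousAt (fderiv ℝ F) x₀ :=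
    (hF.continuousOn_fderiv_of_isOpen hU (by norm_num)).continuousAt hUx
  have hl₀ : Tendsto l atTop (𝓝 l₀) := tendsto_multiplier hδ hcont hx hv
    ((hx.eventually hUx).mono fun k hk => hbd _ hk _ (hl k))
  have key : ∀ p ∈ lineality (tangentCone C l₀),
      ((inner ℝ (hessOp F x₀ l₀ w) w + 2 * inner ℝ p (fderiv ℝ F x₀ w) : ℝ) : EReal) ≤
        epiLiminf (fun k => subderiv2 φ (x k) (adjDeriv F (x k) (l k))) w := by
    intro p hp
    obtain ⟨q, hq, hqp⟩ := hlim hp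
    choose u hu hun using fun k => exists_mem_outerTangent2_norm_le (hl k) (hM k) (hq k)
    refine coe_le_epiLiminf (b := fun k z => inner ℝ (hessOp F (x k) (l k) z) z +
      2 * inner ℝ (q k) (fderiv ℝ F (x k) z) + inner ℝ (u k) (F (x k))) ?_ ?_
    · filter_upwards [hx.eventually hUx] with k hk z
      refine coe_le_subderiv2_of_mem_outerTangent2 hU hF hrep hk (hl k) (hN k) ?_ (hu k) (hepi k) z
      rw [real_inner_comm]
      exact (mem_lineality_tangentCone_iff hdec.convex (hl k)).1 (hL k (hq k)) _ (hN k)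
    · have h1 : Tendsto (fun a : ℕ × EuclideanSpace ℝ (Fin n) => hessOp F (x a.1) (l a.1) a.2)
          (atTop ×ˢ 𝓝 w) (𝓝 (hessOp F x₀ l₀ w)) :=
        tendsto_clm_apply ((tendsto_hessOp hU hF hx₀ hx hl₀).comp tendsto_fst) tendsto_snd
      have h2 : Tendsto (fun a : ℕ × EuclideanSpace ℝ (Fin n) => fderiv ℝ F (x a.1) a.2)
          (atTop ×ˢ 𝓝 w) (𝓝 (fderiv ℝ F x₀ w)) :=
        tendsto_clm_apply ((hcont.tendsto.comp hx).comp tendsto_fst) tendsto_snd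
      have h3 : Tendsto (fun k => inner ℝ (u k) (F (x k))) atTop (𝓝 0) := by
        have hFx : Tendsto (fun k => F (x k)) atTop (𝓝 0) := by
          rw [← hdec.map_zero]
          exact (hF.continuousOn.continuousAt hUx).tendsto.comp hx
        have h4 := ((hqp.norm.pow 2).const_mul M).mul hFx.norm
        rw [norm_zero, mul_zero] at h4
        refine squeeze_zero_norm (fun k => (norm_inner_le_norm _ _).trans ?_) h4
        gcongr
        exact hun k
      simpa using ((h1.inner tendsto_snd).add
        (((hqp.comp tendsto_fst).inner h2).const_mul 2)).add (h3.comp tendsto_fst)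
  by_cases hw : w ∈ affineSpan ℝ (critCone C F x₀ l₀)
  · have h0 : (0 : EuclideanSpace ℝ (Fin m)) ∈ lineality (tangentCone C l₀) := by
      intro y hy t
      simpa using hy
    have := key 0 h0
    rw [inner_zero_left, mul_zero, add_zero, real_inner_comm] at this
    rw [indicatorFun, if_pos (SetLike.mem_coe.2 hw), add_zero]
    exact this
  · obtain ⟨p, hp, hne⟩ := exists_mem_lineality_inner_ne_zero hdec.convex hdec.mem hdec.strict hw
    have htop : epiLiminf (fun k => subderiv2 φ (x k) (adjDeriv F (x k) (l k))) w = ⊤ := by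
      refine EReal.eq_top_iff_forall_lt _ |>.2 fun y => ?_
      -- The multiple of `p` is chosen such that the bound equals `y + 1`.
      have hp' : ((y + 1 - inner ℝ (hessOp F x₀ l₀ w) w) / (2 * inner ℝ p (fderiv ℝ F x₀ w))) • p ∈
          lineality (tangentCone C l₀) := by
        rw [mem_lineality_tangentCone_iff hdec.convex hdec.mem] at hp ⊢
        intro v hv
        rw [inner_smul_right, hp v hv, mul_zero]
      refine lt_of_lt_of_le ?_ (key _ hp')
      rw [EReal.coe_lt_coe_iff, real_inner_smul_left]
      have : inner ℝ (hessOp F x₀ l₀ w) w + 2 * ((y + 1 - inner ℝ (hessOp F x₀ l₀ w) w) /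
          (2 * inner ℝ p (fderiv ℝ F x₀ w)) * inner ℝ p (fderiv ℝ F x₀ w)) = y + 1 := by
        field_simp
        ring
      rw [this]
      linarith
    rw [htop]
    exact le_top

/-- On the affine hull of the critical cone, the quadratic forms of `Q` and `H(x, l)` agree. -/
theorem inner_critOp_self {x w : EuclideanSpace ℝ (Fin n)} {l : EuclideanSpace ℝ (Fin m)}
    (hw : w ∈ affineSpan ℝ (critCone C F x l)) :
    inner ℝ w (critOp C F x l w) = inner ℝ w (hessOp F x l w) := by
  have h0 : (0 : EuclideanSpace ℝ (Fin n)) ∈ affineSpan ℝ (critCone C F x l) := by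
    refine subset_affineSpan ℝ _ ?_
    rw [critCone, Set.mem_preimage, map_zero]
    exact zero_mem_normalCone C l
  have hdir : w ∈ (affineSpan ℝ (critCone C F x l)).direction := by
    simpa using AffineSubspace.vsub_mem_direction hw h0
  have hproj := Submodule.starProjection_eq_self_iff.2 hdir
  rw [critOp, ContinuousLinearMap.comp_apply, ContinuousLinearMap.comp_apply, hproj,
    ← Submodule.inner_starProjection_left_eq_right, hproj]

end Decomposable

end SecondOrderVar

open SecondOrderVar in
theorem mainTheorem2 {n m : ℕ} (φ : EuclideanSpace ℝ (Fin n) → EReal) (hφ : ∀ x, φ x ≠ ⊥)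
    (C : Set (EuclideanSpace ℝ (Fin m)))
    (F : EuclideanSpace ℝ (Fin n) → EuclideanSpace ℝ (Fin m))
    (x₀ v₀ : EuclideanSpace ℝ (Fin n)) (l₀ : EuclideanSpace ℝ (Fin m))
    (hdec : IsStrictlyDecomposable 2 φ C F x₀ l₀)
    (hv₀ : v₀ = adjDeriv F x₀ l₀) :
    (∀ (x v : ℕ → EuclideanSpace ℝ (Fin n)) (l : ℕ → EuclideanSpace ℝ (Fin m))
      (L : ℕ → Submodule ℝ (EuclideanSpace ℝ (Fin m))) (M : ℝ),
      (∀ k, v k ∈ subdiff φ (x k)) →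
      Tendsto x atTop (𝓝 x₀) → Tendsto v atTop (𝓝 v₀) →
      (∀ k, TwiceEpiDiff φ (x k) (v k)) →
      0 < M →
      (∀ k, v k = adjDeriv F (x k) (l k)) →
      (∀ k, l k ∈ subdiff (supportFun C) (F (x k))) →
      (∀ k, (L k : Set (EuclideanSpace ℝ (Fin m))) ⊆ lineality (tangentCone C (l k))) →
      SetConverges (fun k => (L k : Set (EuclideanSpace ℝ (Fin m))))
        (lineality (tangentCone C l₀)) →
      (∀ k, ∀ p ∈ L k, ‖p‖ = 1 →
        Metric.infEDist 0 (outerTangent2 C (l k) p) < ENNReal.ofReal M) →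
      ∀ w, ((inner ℝ w (hessOp F x₀ l₀ w) : ℝ) : EReal) +
          indicatorFun (affineSpan ℝ (critCone C F x₀ l₀) : Set (EuclideanSpace ℝ (Fin n))) w ≤
        epiLiminf (fun k => subderiv2 φ (x k) (adjDeriv F (x k) (l k))) w) ∧
    (HasOTP C l₀ →
      HasSubderivLowerBound φ x₀ v₀ (critOp C F x₀ l₀) (critCone C F x₀ l₀)) := by
  subst hv₀
  constructor
  · intro x v l L M _ hx hv hepi _ hvl hl hL hlim hM w
    have h := fun k => mem_normalCone_of_mem_subdiff_supportFun hdec.closed hdec.convex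
      hdec.nonempty (hl k)
    obtain rfl : v = fun k => adjDeriv F (x k) (l k) := funext hvl
    exact le_epiLiminf_subderiv2 hdec (hφ x₀) hx hv hepi (fun k => (h k).1) (fun k => (h k).2) hL
      hlim.2.ge hM w
  · rintro ⟨M, -, V, hV, L, hL, hlim, hM⟩ x v hsub hx hv hepi - w
    obtain ⟨U, r₀, δ, hU, hx₀, hF, hrep, hδ, hbd⟩ := hdec.exists_nhd (hφ x₀)
    have hcont : ContinuousOn (fderiv ℝ F) U := hF.continuousOn_fderiv_of_isOpen hU (by norm_num)
    have hdiff : ∀ y ∈ U, DifferentiableAt ℝ F y := fun y hy =>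
      (hF.contDiffAt (hU.mem_nhds hy)).differentiableAt two_ne_zero
    -- Multipliers exist for those `k` for which `x k` is close to `x₀`.
    have hmul : ∀ k, ∃ μ, x k ∈ U →
        μ ∈ C ∧ F (x k) ∈ normalCone C μ ∧ v k = adjDeriv F (x k) μ := by
      intro k
      by_cases hk : x k ∈ U
      · obtain ⟨μ, h1, h2, h3⟩ := exists_multiplier_of_mem_subdiff hdec.closed hdec.convex
          hdec.nonempty hU hrep hdiff hcont hδ hbd hk (hsub k)
        exact ⟨μ, fun _ => ⟨h1, h2, h3⟩⟩
      · exact ⟨0, fun h => absurd h hk⟩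
    choose l hl using hmul
    have hxU : ∀ᶠ k in atTop, x k ∈ U := hx.eventually (hU.mem_nhds hx₀)
    have hll : Tendsto l atTop (𝓝 l₀) :=
      tendsto_multiplier hδ (hcont.continuousAt (hU.mem_nhds hx₀)) hx
        (hv.congr' (hxU.mono fun k hk => (hl k hk).2.2))
        (hxU.mono fun k hk => hbd _ hk _ (hl k hk).1)
    obtain ⟨N, hN⟩ := eventually_atTop.1 (hxU.and (hll.eventually hV))
    have hl' := fun k => hl (k + N) (hN (k + N) (by omega)).1
    have hmem : ∀ k, l (k + N) ∈ C ∩ V := fun k => ⟨(hl' k).1, (hN (k + N) (by omega)).2⟩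
    have hvN : ∀ k, v (k + N) = adjDeriv F (x (k + N)) (l (k + N)) := fun k => (hl' k).2.2
    have main := le_epiLiminf_subderiv2 hdec (hφ x₀) (x := fun k => x (k + N))
      (l := fun k => l (k + N)) (L := fun k => L (l (k + N))) (M := M)
      (hx.comp (tendsto_add_atTop_nat N))
      ((hv.comp (tendsto_add_atTop_nat N)).congr hvN) (fun k => hvN k ▸ hepi (k + N))
      (fun k => (hl' k).1) (fun k => (hl' k).2.1) (fun k => hL _ (hmem k))
      (hlim _ hmem (hll.comp (tendsto_add_atTop_nat N))).2.ge (fun k => hM _ (hmem k)) w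
    have hfun : (fun k => subderiv2 φ (x (k + N)) (adjDeriv F (x (k + N)) (l (k + N)))) =
        fun k => subderiv2 φ (x (k + N)) (v (k + N)) := funext fun k => by rw [hvN k]
    rw [hfun, epiLiminf_comp_add (fun k => subderiv2 φ (x k) (v k)) N w] at main
    refine le_trans ?_ main
    by_cases hw : w ∈ affineSpan ℝ (critCone C F x₀ l₀)
    · rw [inner_critOp_self hw]
    · rw [indicatorFun, if_neg (fun h => hw (SetLike.mem_coe.1 h)),
        EReal.coe_add_top, EReal.coe_add_top]
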